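/- Let $H_1,H_2,\dots$ be independent complex fading coefficients with Rayleigh fading of unit mean square, i.e. each $|H_k|^2$ is exponentially distributed with mean $1$. Fix a threshold $\tau>0$, a power share $g_0\in[0,1]$ and a total power $\rho>0$. With $K$ parallel channels, let $K_0$ be the number of $k\le K$ with $|H_k|^2\le\tau$ and $K_1=K-K_0$; each channel with $|H_k|^2\le\tau$ is given the input power $g_0\rho/K_0$ and each channel with $|H_k|^2>\tau$ the input power $(1-g_0)\rho/K_1$. The total achievable rate is $$R(K,\rho)=\sum_{k\le K,\ |H_k|^2\le\tau}\log\Bigl(1+\frac{g_0\rho}{K_0}|H_k|^2\Bigr)+\sum_{k\le K,\ |H_k|^2>\tau}\log\Bigl(1+\frac{(1-g_0)\rho}{K_1}|H_k|^2\Bigr),$$ where an empty sum is $0$. For $\eta>0$ let $$\mathcal E(\eta)=\lim_{K\to\infty}\frac{-\log\Pr[R(K,\rho)\le\rho/\eta]}{K}$$ be the wideband outage exponent at energy per nat $\eta$, and let $\bar\eta=\bigl[\tau+1-\frac{g_0\tau}{1-e^{-\tau}}\bigr]^{-1}$ be the wideband minimum energy per nat. Put, with suprema in $(-\infty,+\infty]$,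 $$\tilde{\mathcal E}_0(\eta)=\sup_{\lambda\le0}\Bigl\{\frac{\lambda}{\eta}+\log(1-g_0\lambda)-\log\bigl[1-e^{-(1-g_0\lambda)\tau}\bigr]\Bigr\}$$ and, for $0<x<1$, $$\tilde{\mathcal E}(\eta,x)=\sup_{\lambda\le0}\Bigl\{\frac{\lambda}{\eta}-x\log\bigl[e^{(1-g_0\lambda/x)\tau}-1\bigr]+x\log(x-g_0\lambda)+(1-x)\log[1-x-(1-g_0)\lambda]+(1-\lambda)\tau\Bigr\}.$$ Then, for every $\rho>0$, the limit $\mathcal E(\eta)$ exists for every $\eta\ge\bar\eta$ and $$\mathcal E(\eta)=\begin{cases}\min\bigl\{\inf_{x\in(0,1)}\tilde{\mathcal E}(\eta,x),\ \tilde{\mathcal E}_0(\eta)\bigr\}&\text{if }\bar\eta\le\eta\le\frac1{(1-g_0)\tau},\\[2pt]\tilde{\mathcal E}_0(\eta)&\text{if }\eta>\frac1{(1-g_0)\tau},\end{cases}$$ where $\frac1{(1-g_0)\tau}$ is read as $+\infty$ when $g_0=1$. -/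

import Mathlib

open MeasureTheory ProbabilityTheory Filter Topology

namespace Wideband

/-- Rayleigh fading, normalized to unit mean square: the fading coefficients `H k` of the parallel
channels are mutually independent complex random variables, and each squared fading coefficient
`|H k|²` is exponentially distributed with mean one. -/
structure IsRayleighFading {Ω : Type*} [MeasurableSpace Ω] (μ : Measure Ω)
    (H : ℕ → Ω → ℂ) : Prop where
  aemeasurable : ∀ k, AEMeasurable (H k) μ
  indep : iIndepFun H μ
  law : ∀ k, HasLaw (fun ω => ‖H k ω‖ ^ 2) (expMeasure 1) μ

/-- The one-bit feedback for a channel with fading coefficient `h` and threshold `τ`. -/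
noncomputable def feedback (τ : ℝ) (h : ℂ) : ℕ := if ‖h‖ ^ 2 ≤ τ then 0 else 1

/-- The number of channels, among the first `K`, whose feedback bit is `b`. -/
noncomputable def numChannels (τ : ℝ) (K : ℕ) (h : ℕ → ℂ) (b : ℕ) : ℕ :=
  ((Finset.range K).filter fun k => feedback τ (h k) = b).card

/-- The input power of channel `k`: the power `g₀ ρ` is divided equally among the channels with
feedback `0`, and `(1 - g₀) ρ` equally among those with feedback `1`. (For `k < K` the
denominator is positive, since channel `k` itself is counted in it.) -/
noncomputable def power (τ g₀ ρ : ℝ) (K : ℕ) (h : ℕ → ℂ) (k : ℕ) : ℝ :=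
  if feedback τ (h k) = 0 then g₀ / (numChannels τ K h 0 : ℝ) * ρ
  else (1 - g₀) / (numChannels τ K h 1 : ℝ) * ρ

/-- The total achievable rate (in nats) over `K` channels with fading coefficients `h`. -/
noncomputable def rate (τ g₀ ρ : ℝ) (K : ℕ) (h : ℕ → ℂ) : ℝ :=
  ∑ k ∈ Finset.range K, Real.log (1 + power τ g₀ ρ K h k * ‖h k‖ ^ 2)

/-- The outage probability `Pr[R(K, ρ) ≤ r]` for the target rate `r`. -/
noncomputable def outageProb {Ω : Type*} [MeasurableSpace Ω] (μ : Measure Ω) (H : ℕ → Ω → ℂ)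
    (τ g₀ ρ r : ℝ) (K : ℕ) : ENNReal :=
  μ {ω | rate τ g₀ ρ K (fun k => H k ω) ≤ r}

/-- The wideband outage exponent at energy per nat `η` (that is, at target rate `r = ρ / η`)
exists and equals `e`:  `-log Pr[R(K, ρ) ≤ ρ / η] / K → e` as `K → ∞`. Logarithms of
probabilities are extended, with `-log 0 = +∞`. -/
def HasOutageExponent {Ω : Type*} [MeasurableSpace Ω] (μ : Measure Ω) (H : ℕ → Ω → ℂ)
    (τ g₀ ρ η : ℝ) (e : EReal) : Prop :=
  Tendsto (fun K : ℕ => (-ENNReal.log (outageProb μ H τ g₀ ρ (ρ / η) K)) / (K : EReal))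
    atTop (𝓝 e)

/-- The wideband minimum energy per nat of the protocol. -/
noncomputable def etaBar (τ g₀ : ℝ) : ℝ :=
  (τ + 1 - g₀ * τ / (1 - Real.exp (-τ)))⁻¹

/-- `Ẽ₀(η)`, a supremum in the extended reals. -/
noncomputable def E0 (τ g₀ η : ℝ) : EReal :=
  ⨆ (l : ℝ) (_ : l ≤ 0),
    ((l / η + Real.log (1 - g₀ * l)
      - Real.log (1 - Real.exp (-((1 - g₀ * l) * τ))) : ℝ) : EReal)

/-- `Ẽ(η, x)`, a supremum in the extended reals. -/
noncomputable def E1 (τ g₀ η x : ℝ) : EReal :=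
  ⨆ (l : ℝ) (_ : l ≤ 0),
    ((l / η - x * Real.log (Real.exp ((1 - g₀ * l / x) * τ) - 1)
      + x * Real.log (x - g₀ * l)
      + (1 - x) * Real.log (1 - x - (1 - g₀) * l) + (1 - l) * τ : ℝ) : EReal)

end Wideband

namespace Wideband

/-! With `ρ` fixed, the power of a channel is of order `1/K`, so `log (1 + t)` may be replaced by
`t`. Given the fraction `x` of channels with feedback `0`, the rate becomes `ρ` times a linear
function of the sums of the squared moduli of either kind, divided by `K`. The result is then of
Cramér type at level `c = 1/η`: the exponent at `x` is the Legendre transform `sup_{l ≤ 0} (dual τ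
g₀ x l + l * c)`, and the most likely `x` decides. The value `x = 1` gives `E0`, and `0 < x < 1`
gives `E1`.

Upper bound on the probability: `chernoff_bound` treats each count of channels with feedback `0`,
`tendsto_integral_factor` identifies the limiting exponent, and compactness of `[0, 1]` makes the
estimate uniform over the `K + 1` counts (`eventually_pi_le`). The endpoint `x = 0` is absent from
the formula; `exists_lt_highCgf` shows that it cannot undercut the infimum over `(0, 1)`.

Lower bound: `exists_tilt` supplies a tilted law whose mean rate is strictly below `c` and whose
relative entropy is close to the exponent. A change of measure and the weak law of large numbers
conclude (`eventually_le_pi_gainRate`); here `log (1 + t) ≤ t` suffices.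

If `1/η ≤ (1 - g₀) τ`, the channels above the threshold alone exceed the target in the linear limit,
so `E1` is infinite (`E1_eq_top`) and only `x = 1` remains. -/

/-! ### Truncated exponential laws and their cumulant generating functions. -/

lemma setIntegral_expMeasure (f : ℝ → ℝ) {s : Set ℝ} (hs : MeasurableSet s) :
    ∫ y in s, f y ∂(expMeasure 1) = ∫ y in s ∩ Set.Ici 0, Real.exp (-y) * f y := by
  have h : expMeasure 1 = volume.withDensity (exponentialPDF 1) := rfl
  have hm : Measurable (exponentialPDF 1) :=
    (measurable_exponentialPDFReal 1).ennreal_ofReal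
  rw [h, setIntegral_withDensity_eq_setIntegral_toReal_smul hm
    (ae_of_all _ fun x => by simp [exponentialPDF]) _ hs, ← setIntegral_indicator measurableSet_Ici]
  congr 1 with y
  by_cases hy : 0 ≤ y
  · simp [exponentialPDF_of_nonneg hy, hy, Real.exp_nonneg]
  · simp [exponentialPDF_of_neg (not_le.1 hy), hy]

lemma ae_nonneg_expMeasure : ∀ᵐ y ∂(expMeasure 1), 0 ≤ y := by
  have h : expMeasure 1 = volume.withDensity (exponentialPDF 1) := rfl
  have hm : Measurable (exponentialPDF 1) :=
    (measurable_exponentialPDFReal 1).ennreal_ofReal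
  rw [h, ae_withDensity_iff hm]
  refine ae_of_all _ fun y hy => ?_
  by_contra hn
  exact hy (exponentialPDF_of_neg (not_le.1 hn))

/-- The modulus changes nothing almost surely; it makes later bounds, such as `factor_le_one`, hold
for every real `y`. -/
lemma integrable_exp_mul_abs_expMeasure {θ : ℝ} (hθ : θ < 1) :
    Integrable (fun y => Real.exp (θ * |y|)) (expMeasure 1) := by
  have h : expMeasure 1 = volume.withDensity (exponentialPDF 1) := rfl
  have hm : Measurable (exponentialPDF 1) :=
    (measurable_exponentialPDFReal 1).ennreal_ofReal
  rw [h, integrable_withDensity_iff_integrable_smul' hm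
    (ae_of_all _ fun x => by simp [exponentialPDF])]
  have : (fun y => (exponentialPDF 1 y).toReal • Real.exp (θ * |y|)) =
      (Set.Ici 0).indicator fun y => Real.exp (-(1 - θ) * y) := by
    ext y
    by_cases hy : 0 ≤ y
    · simp only [exponentialPDF_of_nonneg hy, Set.mem_Ici, hy, Set.indicator_of_mem, one_mul,
        Real.exp_nonneg, ENNReal.toReal_ofReal, smul_eq_mul, abs_of_nonneg]
      rw [← Real.exp_add]; ring_nf
    · simp [exponentialPDF_of_neg (not_le.1 hy), hy]
  rw [this, integrable_indicator_iff measurableSet_Ici, integrableOn_Ici_iff_integrableOn_Ioi]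
  exact exp_neg_integrableOn_Ioi 0 (by linarith)

lemma setIntegral_Ioi_exp_mul_abs {τ θ : ℝ} (hτ : 0 ≤ τ) (hθ : θ < 1) :
    ∫ y in Set.Ioi τ, Real.exp (θ * |y|) ∂(expMeasure 1) =
      Real.exp (-((1 - θ) * τ)) / (1 - θ) := by
  rw [setIntegral_expMeasure _ measurableSet_Ioi]
  have hs : Set.Ioi τ ∩ Set.Ici 0 = Set.Ioi τ :=
    Set.inter_eq_left.2 fun y hy => hτ.trans (le_of_lt hy)
  rw [hs, setIntegral_congr_fun measurableSet_Ioi (g := fun y => Real.exp (-(1 - θ) * y)),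
    integral_exp_mul_Ioi (by linarith)]
  · rw [div_neg, neg_div, neg_neg]; congr 2; ring
  · intro y hy
    simp only
    rw [abs_of_nonneg (hτ.trans (le_of_lt hy)), ← Real.exp_add]; ring_nf

lemma integral_exp_mul_abs_expMeasure {θ : ℝ} (hθ : θ < 1) :
    ∫ y, Real.exp (θ * |y|) ∂(expMeasure 1) = 1 / (1 - θ) := by
  have h := setIntegral_Ioi_exp_mul_abs le_rfl hθ
  have h2 : ∫ y in Set.Ioi 0, Real.exp (θ * |y|) ∂(expMeasure 1) =
      ∫ y in Set.Ici 0, Real.exp (θ * |y|) ∂(expMeasure 1) := by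
    rw [setIntegral_expMeasure _ measurableSet_Ioi, setIntegral_expMeasure _ measurableSet_Ici,
      Set.inter_self, Set.inter_eq_left.2 Set.Ioi_subset_Ici_self, integral_Ici_eq_integral_Ioi]
  rw [h2] at h
  rw [← setIntegral_eq_integral_of_ae_compl_eq_zero (s := Set.Ici 0), h]
  · simp
  · filter_upwards [ae_nonneg_expMeasure] with y hy hn
    exact absurd hy hn

lemma setIntegral_Iic_exp_mul_abs {τ θ : ℝ} (hτ : 0 ≤ τ) (hθ : θ < 1) :
    ∫ y in Set.Iic τ, Real.exp (θ * |y|) ∂(expMeasure 1) =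
      (1 - Real.exp (-((1 - θ) * τ))) / (1 - θ) := by
  have h := integral_add_compl (measurableSet_Iic (a := τ)) (integrable_exp_mul_abs_expMeasure hθ)
  rw [Set.compl_Iic, setIntegral_Ioi_exp_mul_abs hτ hθ, integral_exp_mul_abs_expMeasure hθ] at h
  rw [sub_div]; linarith

/-- The law of the squared modulus, restricted to the channels with feedback `0`. -/
noncomputable def lowLaw (τ : ℝ) : Measure ℝ := (expMeasure 1).restrict (Set.Iic τ)

/-- The law of the squared modulus, restricted to the channels with feedback `1`. -/
noncomputable def highLaw (τ : ℝ) : Measure ℝ := (expMeasure 1).restrict (Set.Ioi τ)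

instance : IsProbabilityMeasure (expMeasure 1) := isProbabilityMeasure_expMeasure one_pos

instance (τ : ℝ) : IsFiniteMeasure (lowLaw τ) := by unfold lowLaw; infer_instance

instance (τ : ℝ) : IsFiniteMeasure (highLaw τ) := by unfold highLaw; infer_instance

/-- The cumulant generating function of the channels with feedback `0`. -/
noncomputable def lowCgf (τ : ℝ) : ℝ → ℝ := cgf (fun y => |y|) (lowLaw τ)

/-- The cumulant generating function of the channels with feedback `1`. -/
noncomputable def highCgf (τ : ℝ) : ℝ → ℝ := cgf (fun y => |y|) (highLaw τ)

lemma mem_interior_integrableExpSet_of_le {μ : Measure ℝ} (hμ : μ ≤ expMeasure 1) {θ : ℝ}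
    (hθ : θ < 1) : θ ∈ interior (integrableExpSet (fun y => |y|) μ) := by
  have h : Set.Iio 1 ⊆ integrableExpSet (fun y => |y|) μ := fun t ht =>
    (integrable_exp_mul_abs_expMeasure ht).mono_measure hμ
  exact interior_mono h (by simpa [isOpen_Iio.interior_eq] using hθ)

lemma mem_interior_lowLaw {τ θ : ℝ} (hθ : θ < 1) :
    θ ∈ interior (integrableExpSet (fun y => |y|) (lowLaw τ)) :=
  mem_interior_integrableExpSet_of_le Measure.restrict_le_self hθ

lemma mem_interior_highLaw {τ θ : ℝ} (hθ : θ < 1) :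
    θ ∈ interior (integrableExpSet (fun y => |y|) (highLaw τ)) :=
  mem_interior_integrableExpSet_of_le Measure.restrict_le_self hθ

lemma lowLaw_ne_zero {τ : ℝ} (hτ : 0 < τ) : lowLaw τ ≠ 0 := by
  intro h
  have := setIntegral_Iic_exp_mul_abs hτ.le (θ := 0) one_pos
  change ∫ y, _ ∂(lowLaw τ) = _ at this
  rw [h] at this
  simp at this
  have h2 : Real.exp (-τ) < 1 := by simpa using hτ
  linarith

lemma highLaw_ne_zero {τ : ℝ} (hτ : 0 < τ) : highLaw τ ≠ 0 := by
  intro h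
  have := setIntegral_Ioi_exp_mul_abs hτ.le (θ := 0) one_pos
  change ∫ y, _ ∂(highLaw τ) = _ at this
  rw [h] at this
  simp at this
  exact (Real.exp_pos (-τ)).ne this

/-- `highLaw` and `lowLaw` are not normalized, so these functions already contain the
log-probability of the feedback value. Hence `dual` contains the entropy of `x` rather than a
relative entropy. -/
lemma highCgf_eq {τ θ : ℝ} (hτ : 0 < τ) (hθ : θ < 1) :
    highCgf τ θ = -((1 - θ) * τ) - Real.log (1 - θ) := by
  have h : mgf (fun y => |y|) (highLaw τ) θ = _ := setIntegral_Ioi_exp_mul_abs hτ.le hθ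
  rw [highCgf, cgf, h, Real.log_div (Real.exp_ne_zero _) (by linarith), Real.log_exp]

lemma lowCgf_eq {τ θ : ℝ} (hτ : 0 < τ) (hθ : θ < 1) :
    lowCgf τ θ = Real.log (1 - Real.exp (-((1 - θ) * τ))) - Real.log (1 - θ) := by
  have h : mgf (fun y => |y|) (lowLaw τ) θ = _ := setIntegral_Iic_exp_mul_abs hτ.le hθ
  have : Real.exp (-((1 - θ) * τ)) < 1 := by
    rw [Real.exp_lt_one_iff]; nlinarith
  rw [lowCgf, cgf, h, Real.log_div (by linarith) (by linarith)]

lemma hasDerivAt_lowCgf {τ θ : ℝ} (hθ : θ < 1) :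
    HasDerivAt (lowCgf τ) (deriv (lowCgf τ) θ) θ :=
  (analyticAt_cgf (mem_interior_lowLaw hθ)).differentiableAt.hasDerivAt

lemma hasDerivAt_highCgf {τ θ : ℝ} (hθ : θ < 1) :
    HasDerivAt (highCgf τ) (deriv (highCgf τ) θ) θ :=
  (analyticAt_cgf (mem_interior_highLaw hθ)).differentiableAt.hasDerivAt

lemma lowCgf_nonpos {τ θ : ℝ} (hτ : 0 < τ) (hθ : θ ≤ 0) : lowCgf τ θ ≤ 0 := by
  rw [lowCgf_eq hτ (by linarith)]
  have h1 := Real.log_nonneg (x := 1 - θ) (by linarith)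
  have : Real.exp (-((1 - θ) * τ)) < 1 := by
    rw [Real.exp_lt_one_iff]; nlinarith
  have h2 := Real.log_nonpos (x := 1 - Real.exp (-((1 - θ) * τ))) (by linarith)
    (by linarith [Real.exp_pos (-((1 - θ) * τ))])
  linarith

/-- The integral of `exp (-(1 - θ) y)` over `[0, τ]` is at least that over `[0, s]`, hence at least
`s * exp (-(1 - θ) s)`. A small `s` means that channels with feedback `0` can be nearly silent at a
bounded cost. -/
lemma le_lowCgf {τ θ s : ℝ} (hs : 0 < s) (hsτ : s ≤ τ) (hθ : θ ≤ 0) :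
    Real.log s + θ * s - s ≤ lowCgf τ θ := by
  have hτ : 0 < τ := hs.trans_le hsτ
  rw [lowCgf_eq hτ (by linarith)]
  have h0 : 0 < 1 - θ := by linarith
  have h1 : Real.exp (-((1 - θ) * τ)) ≤ Real.exp (-((1 - θ) * s)) := by
    rw [Real.exp_le_exp]; nlinarith
  have h2 : (1 - θ) * s * Real.exp (-((1 - θ) * s)) ≤ 1 - Real.exp (-((1 - θ) * s)) := by
    have := Real.add_one_le_exp ((1 - θ) * s)
    have h3 : Real.exp ((1 - θ) * s) * Real.exp (-((1 - θ) * s)) = 1 := by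
      rw [← Real.exp_add]; simp
    nlinarith [Real.exp_pos (-((1 - θ) * s))]
  have h4 := Real.log_le_log (by positivity) (h2.trans (sub_le_sub_left h1 1))
  rw [Real.log_mul (by positivity) (Real.exp_ne_zero _), Real.log_mul h0.ne' hs.ne',
    Real.log_exp] at h4
  linarith

/-! ### Legendre duality on the half-line `l ≤ 0`. -/

/-- Legendre duality: a lower bound for the supremum of `Φ l + c l` over `l ≤ 0` by the value of the
rate function at a point where the tilted mean `-Φ'` is below `c`. -/
lemma exists_tilt {Φ Φ' : ℝ → ℝ} (hΦ : ∀ l ≤ 0, HasDerivAt Φ (Φ' l) l) {c₀ c M₀ E δ : ℝ}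
    (hc : c₀ < c) (hM₀ : ∀ l ≤ 0, Φ l + l * c₀ ≤ M₀) (hE : ∀ l ≤ 0, Φ l + l * c ≤ E)
    (hδ : 0 < δ) : ∃ l ≤ 0, -Φ' l < c ∧ Φ l - l * Φ' l ≤ E + δ := by
  have ht' : ∃ t : ℝ, 0 < t ∧ t < 1 ∧ t * (M₀ - E) ≤ δ := by
    refine ⟨min (1 / 2) (δ / (|M₀ - E| + 1)), by positivity,
      (min_le_left _ _).trans_lt (by norm_num), ?_⟩
    calc min (1 / 2) (δ / (|M₀ - E| + 1)) * (M₀ - E)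
        ≤ min (1 / 2) (δ / (|M₀ - E| + 1)) * (|M₀ - E| + 1) := by
          gcongr; linarith [le_abs_self (M₀ - E)]
      _ ≤ δ / (|M₀ - E| + 1) * (|M₀ - E| + 1) := by gcongr; exact min_le_right _ _
      _ = δ := by field_simp
  obtain ⟨t, ht, ht1, htδ⟩ := ht'
  -- A level slightly below `c` makes the mean inequality strict. The value there is controlled by
  -- interpolating between `c` and `c₀`, at a cost of at most `δ` by the choice of `t`.
  set c' := c - t * (c - c₀) with hc'
  have h1 : c₀ < c' := by nlinarith
  have h2 : c' < c := by nlinarith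
  have hE' : ∀ l ≤ 0, Φ l + l * c' ≤ E + δ := fun l hl => by
    have := hM₀ l hl
    have := hE l hl
    have : Φ l + l * c' = (1 - t) * (Φ l + l * c) + t * (Φ l + l * c₀) := by rw [hc']; ring
    nlinarith
  -- Beyond `-L` the bound at `c₀` forces the objective below its value at `0`, so a maximizer over
  -- the compact interval is global.
  obtain ⟨L, hL0, hL⟩ : ∃ L ≥ 0, M₀ - L * (c' - c₀) ≤ Φ 0 := by
    refine ⟨|M₀ - Φ 0| / (c' - c₀), by have := sub_pos.2 h1; positivity, ?_⟩
    rw [div_mul_cancel₀ _ (sub_pos.2 h1).ne']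
    linarith [le_abs_self (M₀ - Φ 0)]
  obtain ⟨l, ⟨hlL, hl⟩, hmax⟩ := (isCompact_Icc (a := -L) (b := 0)).exists_isMaxOn
    ⟨0, by simp [hL0]⟩ (f := fun l => Φ l + l * c')
    (fun l hl => (((hΦ l hl.2).continuousAt).add (by fun_prop)).continuousWithinAt)
  have hmax' : ∀ u ≤ 0, Φ u + u * c' ≤ Φ l + l * c' := fun u hu => by
    rcases le_total (-L) u with h | h
    · exact hmax ⟨h, hu⟩
    · have h0 : Φ 0 + 0 * c' ≤ Φ l + l * c' := hmax ⟨by linarith, le_rfl⟩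
      have := hM₀ u hu
      nlinarith
  have hd : HasDerivAt (fun u => Φ u + u * c') (Φ' l + c') l := by
    have h := (hΦ l hl).add ((hasDerivAt_id l).mul_const c')
    rw [one_mul] at h
    exact h
  -- First-order condition: the derivative vanishes at an interior maximizer and is nonnegative at
  -- the endpoint `l = 0`.
  have key : 0 ≤ Φ' l + c' ∧ l * (Φ' l + c') = 0 := by
    rcases hl.lt_or_eq with h | h
    · have : IsLocalMax (fun u => Φ u + u * c') l := by
        filter_upwards [gt_mem_nhds h] with u hu using hmax' u hu.le
      have := this.hasDerivAt_eq_zero hd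
      simp [this]
    · subst h
      refine ⟨?_, by simp⟩
      have hs := hd.hasDerivWithinAt (s := Set.Iio 0)
      rw [hasDerivWithinAt_iff_tendsto_slope' (by simp)] at hs
      refine ge_of_tendsto hs ?_
      filter_upwards [self_mem_nhdsWithin] with u hu
      rw [slope_def_field]
      exact div_nonneg_of_nonpos (by simpa using hmax' u (le_of_lt hu)) (by simpa using (le_of_lt hu))
  refine ⟨l, hl, by linarith [key.1], ?_⟩
  have := hE' l hl
  nlinarith [key.2]

/-! ### The limiting exponent as a function of the fraction `x`: finiteness and boundary behaviour.
-/

/-- The exponent at the fraction `x` of channels with feedback `0`, as a function of the Chernoff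
parameter, up to the linear term. -/
noncomputable def dual (τ g₀ x l : ℝ) : ℝ :=
  -(x * lowCgf τ (g₀ / x * l)) - (1 - x) * highCgf τ ((1 - g₀) / (1 - x) * l) - Real.binEntropy x

/-- The mean rate per unit of power under the tilted law. -/
noncomputable def tiltedMean (τ g₀ x l : ℝ) : ℝ :=
  x * (deriv (lowCgf τ) (g₀ / x * l) * (g₀ / x)) +
    (1 - x) * (deriv (highCgf τ) ((1 - g₀) / (1 - x) * l) * ((1 - g₀) / (1 - x)))

section
variable {τ g₀ x l : ℝ}

lemma low_param_nonpos (hg₀ : 0 ≤ g₀) (hx : 0 ≤ x) (hl : l ≤ 0) : g₀ / x * l ≤ 0 :=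
  mul_nonpos_of_nonneg_of_nonpos (by positivity) hl

lemma high_param_nonpos (hg₁ : g₀ ≤ 1) (hx : x ≤ 1) (hl : l ≤ 0) :
    (1 - g₀) / (1 - x) * l ≤ 0 :=
  mul_nonpos_of_nonneg_of_nonpos (div_nonneg (by linarith) (by linarith)) hl

lemma hasDerivAt_dual (hg₀ : 0 ≤ g₀) (hg₁ : g₀ ≤ 1) (hx0 : 0 ≤ x) (hx1 : x ≤ 1) (hl : l ≤ 0) :
    HasDerivAt (dual τ g₀ x) (-tiltedMean τ g₀ x l) l := by
  have h0 := low_param_nonpos hg₀ hx0 hl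
  have h1 := high_param_nonpos hg₁ hx1 hl
  have d0 : HasDerivAt (fun l => lowCgf τ (g₀ / x * l)) _ l :=
    (hasDerivAt_lowCgf (τ := τ) (h0.trans_lt one_pos)).comp l
      ((hasDerivAt_id l).const_mul (g₀ / x))
  have d1 : HasDerivAt (fun l => highCgf τ ((1 - g₀) / (1 - x) * l)) _ l :=
    (hasDerivAt_highCgf (τ := τ) (h1.trans_lt one_pos)).comp l
      ((hasDerivAt_id l).const_mul ((1 - g₀) / (1 - x)))
  refine (((d0.const_mul x).neg.sub (d1.const_mul (1 - x))).sub_const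
    (Real.binEntropy x)).congr_deriv ?_
  simp only [tiltedMean, mul_one]; ring

/-- An upper bound for the exponent, comparing it with the one where all channels have feedback
`1`. -/
lemma dual_le (hτ : 0 < τ) (hg₀ : 0 ≤ g₀) (hg₁ : g₀ ≤ 1) (hx0 : 0 < x) (hx1 : x < 1) {s : ℝ}
    (hs : 0 < s) (hsτ : s ≤ τ) (hl : l ≤ 0) :
    dual τ g₀ x l ≤ -(g₀ * s * l) - highCgf τ ((1 - g₀) * l) + x * (s - Real.log s) := by
  have h0 := low_param_nonpos hg₀ hx0.le hl
  have h1 := high_param_nonpos hg₁ hx1.le hl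
  have h2 : (1 - g₀) * l ≤ 0 := mul_nonpos_of_nonneg_of_nonpos (by linarith) hl
  have hx1' : 0 < 1 - x := by linarith
  have ha := le_lowCgf hs hsτ h0
  have hb := highCgf_eq hτ (h1.trans_lt one_pos)
  have hb' := highCgf_eq hτ (h2.trans_lt one_pos)
  -- Concavity of `log`, averaging with weight `x` at the point `1`, where `log` vanishes.
  have hconc : (1 - x) * Real.log (1 - (1 - g₀) / (1 - x) * l) ≤ Real.log (1 - (1 - g₀) * l) := by
    have := strictConcaveOn_log_Ioi.concaveOn.2 (x := 1 - (1 - g₀) / (1 - x) * l) (y := 1)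
      (by simp only [Set.mem_Ioi]; linarith) (by simp) hx1'.le hx0.le (by ring)
    simp only [smul_eq_mul, Real.log_one, mul_zero, add_zero] at this
    refine this.trans (le_of_eq ?_)
    congr 1; field_simp; ring
  have hent := Real.binEntropy_nonneg hx0.le hx1.le
  have e1 : x * (Real.log s + g₀ / x * l * s - s) = x * Real.log s + g₀ * l * s - x * s := by
    field_simp
  have e2 : (1 - x) * ((1 - (1 - g₀) / (1 - x) * l) * τ) = ((1 - x) - (1 - g₀) * l) * τ := by
    field_simp
  have := mul_le_mul_of_nonneg_left ha hx0.le
  rw [dual, hb, hb']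
  nlinarith [mul_pos hx0 hτ]

/-- Tangent line of `log` at `1/ε`: the logarithm is absorbed by an arbitrarily small linear term.
-/
lemma log_one_sub_le {ε t : ℝ} (hε : 0 < ε) (ht : t ≤ 0) :
    Real.log (1 - t) ≤ -(ε * t) + ε - 1 - Real.log ε := by
  have := Real.log_le_sub_one_of_pos (x := ε * (1 - t)) (mul_pos hε (by linarith))
  rw [Real.log_mul hε.ne' (by linarith)] at this
  linarith

/-- The exponent is finite at rates above the least contribution of the channels with feedback
`1`. -/
lemma exists_dual_le (hτ : 0 < τ) (hg₀ : 0 ≤ g₀) (hg₁ : g₀ ≤ 1) (hx0 : 0 < x) (hx1 : x < 1) {c : ℝ}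
    (hc : (1 - g₀) * τ < c) : ∃ M, ∀ l ≤ 0, dual τ g₀ x l + l * c ≤ M := by
  obtain ⟨d, hd⟩ : ∃ d, d = (c - (1 - g₀) * τ) / 2 := ⟨_, rfl⟩
  have hd0 : 0 < d := by linarith
  obtain ⟨s, hs⟩ : ∃ s, s = min τ d := ⟨_, rfl⟩
  have hs0 : 0 < s := by rw [hs]; positivity
  refine ⟨τ + d - 1 - Real.log d + x * (s - Real.log s), fun l hl => ?_⟩
  have h2 : (1 - g₀) * l ≤ 0 := mul_nonpos_of_nonneg_of_nonpos (by linarith) hl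
  have h3 := dual_le hτ hg₀ hg₁ hx0 hx1 hs0 (hs ▸ min_le_left _ _) hl
  rw [highCgf_eq hτ (by linarith)] at h3
  have h4 := log_one_sub_le hd0 h2
  have hsd : s ≤ d := hs ▸ min_le_right _ _
  have : g₀ * s + (1 - g₀) * d ≤ 2 * d := by nlinarith
  have : (c - (1 - g₀) * τ - g₀ * s - (1 - g₀) * d) * l ≤ 0 :=
    mul_nonpos_of_nonneg_of_nonpos (by linarith) hl
  nlinarith

/-- At `x = 1` no modulus is bounded away from zero, so every positive level has a finite exponent.
-/
lemma exists_dual_one_le (hg₀ : 0 ≤ g₀) (hg₁ : g₀ ≤ 1) (hτ : 0 < τ) {c : ℝ} (hc : 0 < c) :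
    ∃ M, ∀ l ≤ 0, dual τ g₀ 1 l + l * c ≤ M := by
  obtain ⟨s, hs⟩ : ∃ s, s = min τ c := ⟨_, rfl⟩
  have hs0 : 0 < s := by rw [hs]; positivity
  refine ⟨s - Real.log s, fun l hl => ?_⟩
  have h := le_lowCgf (s := s) hs0 (hs ▸ min_le_left _ _)
    (low_param_nonpos hg₀ zero_le_one hl)
  have hsc : s ≤ c := hs ▸ min_le_right _ _
  have : (c - g₀ * s) * l ≤ 0 := mul_nonpos_of_nonneg_of_nonpos (by nlinarith) hl
  simp only [dual, div_one] at h ⊢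
  simp only [sub_self, zero_mul, Real.binEntropy_one]
  nlinarith

lemma le_dual (hτ : 0 < τ) (hg₀ : 0 ≤ g₀) (hx0 : 0 ≤ x) (hl : l ≤ 0) :
    -((1 - x) * highCgf τ ((1 - g₀) / (1 - x) * l)) - Real.log 2 ≤ dual τ g₀ x l := by
  have := lowCgf_nonpos hτ (low_param_nonpos hg₀ hx0 hl)
  have := Real.binEntropy_le_log_two (p := x)
  rw [dual]
  nlinarith

/-- The exponent is infinite at rates not above the least contribution of the channels with feedback
`1`. -/
lemma exists_lt_dual (hτ : 0 < τ) (hg₀ : 0 ≤ g₀) (hg₁ : g₀ < 1) (hx0 : 0 ≤ x) (hx1 : x < 1) {c : ℝ}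
    (hc : c ≤ (1 - g₀) * τ) (M : ℝ) : ∃ l ≤ 0, M < dual τ g₀ x l + l * c := by
  have hx : 0 < 1 - x := by linarith
  have hg : 0 < 1 - g₀ := by linarith
  obtain ⟨u, hu⟩ : ∃ u, u = |M| + 1 + Real.log 2 := ⟨_, rfl⟩
  have hu0 : 0 < u := by
    rw [hu]; have := Real.log_pos one_lt_two; positivity
  obtain ⟨t, ht⟩ : ∃ t, t = Real.exp (u / (1 - x)) := ⟨_, rfl⟩
  have ht1 : 1 ≤ t := by rw [ht]; exact Real.one_le_exp (by positivity)
  -- This `l` turns the argument of `highCgf` into `1 - t`. The linear terms then leave a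
  -- nonnegative remainder, while the logarithm contributes `(1 - x) * log t = u`.
  refine ⟨(1 - t) * (1 - x) / (1 - g₀), ?_, ?_⟩
  · exact div_nonpos_of_nonpos_of_nonneg
      (mul_nonpos_of_nonpos_of_nonneg (by linarith) hx.le) hg.le
  set l := (1 - t) * (1 - x) / (1 - g₀) with hl
  have hl0 : l ≤ 0 := div_nonpos_of_nonpos_of_nonneg
      (mul_nonpos_of_nonpos_of_nonneg (by linarith) hx.le) hg.le
  have h := le_dual hτ hg₀ hx0 hl0
  have e : (1 - g₀) / (1 - x) * l = 1 - t := by rw [hl]; field_simp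
  rw [e, highCgf_eq hτ (by linarith)] at h
  have e2 : Real.log (1 - (1 - t)) = u / (1 - x) := by
    rw [sub_sub_cancel, ht, Real.log_exp]
  rw [e2] at h
  have e3 : (1 - x) * (-((1 - (1 - t)) * τ) - u / (1 - x)) = -((1 - x) * t * τ) - u := by
    field_simp; ring
  rw [e3] at h
  have e4 : (1 - x) * (t - 1) = -(l * (1 - g₀)) := by rw [hl]; field_simp; ring
  have h5 : 0 ≤ l * (c - (1 - g₀) * τ) := mul_nonneg_of_nonpos_of_nonpos hl0 (by linarith)
  have h6 := le_abs_self M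
  nlinarith

end

/-- The exponent where no channel has feedback `0` is at least the infimum of the others. -/
lemma exists_lt_highCgf {τ g₀ c M : ℝ} (hτ : 0 < τ) (hg₀ : 0 ≤ g₀) (hg₁ : g₀ ≤ 1) (hc0 : 0 < c)
    (hM : ∀ x ∈ Set.Ioo (0 : ℝ) 1, ∃ l ≤ 0, M < dual τ g₀ x l + l * c) {M' : ℝ} (hM' : M' < M) :
    ∃ l ≤ 0, M' < -highCgf τ ((1 - g₀) * l) + l * c := by
  rcases le_or_gt c ((1 - g₀) * τ) with hc | hc
  · have hg : g₀ < 1 := by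
      by_contra h
      have : g₀ = 1 := by linarith
      subst this; simp at hc; linarith
    obtain ⟨l, hl, h⟩ := exists_lt_dual hτ hg₀ hg le_rfl one_pos hc M
    refine ⟨l, hl, ?_⟩
    simp only [dual, zero_mul, sub_zero, div_one, one_mul, Real.binEntropy_zero, neg_zero,
      zero_sub] at h
    linarith
  -- If the exponent at `x = 0` were at most `M'`, interpolation with a finite bound at `c - d`
  -- would keep it below `M` at level `c - t * d`. A small fraction `x` of channels with feedback
  -- `0` and moduli near `s ≤ t * d` fits into this slack at cost `x * (s - log s)`, contradicting
  -- `hM`.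
  by_contra! hcon
  obtain ⟨d, hd⟩ : ∃ d, d = (c - (1 - g₀) * τ) / 3 := ⟨_, rfl⟩
  have hd0 : 0 < d := by linarith
  have hb0 : ∀ l ≤ 0, -highCgf τ ((1 - g₀) * l) + l * (c - d) ≤ τ + d - 1 - Real.log d := by
    intro l hl
    have h2 : (1 - g₀) * l ≤ 0 := mul_nonpos_of_nonneg_of_nonpos (by linarith) hl
    rw [highCgf_eq hτ (by linarith)]
    have h4 := log_one_sub_le hd0 h2
    have : (c - (1 - g₀) * τ - d - (1 - g₀) * d) * l ≤ 0 :=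
      mul_nonpos_of_nonneg_of_nonpos (by nlinarith) hl
    nlinarith
  obtain ⟨M₀, hM₀⟩ : ∃ M₀, M₀ = τ + d - 1 - Real.log d := ⟨_, rfl⟩
  rw [← hM₀] at hb0
  -- interpolation between `c` and `c - d`
  have lim1 : Tendsto (fun t : ℝ => (1 - t) * M' + t * M₀) (𝓝 0) (𝓝 M') := by
    have : Continuous fun t : ℝ => (1 - t) * M' + t * M₀ := by fun_prop
    simpa using this.tendsto 0
  obtain ⟨t, ht, ht0, ht1⟩ : ∃ t : ℝ, (1 - t) * M' + t * M₀ < M ∧ 0 < t ∧ t < 1 := by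
    have h1 := (lim1.eventually (gt_mem_nhds hM')).filter_mono (nhdsWithin_le_nhds (s := Set.Ioi 0))
    have h2 : ∀ᶠ t : ℝ in 𝓝[>] 0, t ∈ Set.Ioo (0 : ℝ) 1 := Ioo_mem_nhdsGT one_pos
    obtain ⟨t, h, h'⟩ := (h1.and h2).exists
    exact ⟨t, h, h'.1, h'.2⟩
  obtain ⟨s, hs⟩ : ∃ s, s = min τ (t * d) := ⟨_, rfl⟩
  have hs0 : 0 < s := by rw [hs]; positivity
  have lim2 : Tendsto (fun x : ℝ => (1 - t) * M' + t * M₀ + x * (s - Real.log s)) (𝓝[>] 0)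
      (𝓝 ((1 - t) * M' + t * M₀)) := by
    have : Continuous fun x : ℝ => (1 - t) * M' + t * M₀ + x * (s - Real.log s) := by fun_prop
    simpa using (this.tendsto 0).mono_left nhdsWithin_le_nhds
  obtain ⟨x, hx, hx'⟩ := ((lim2.eventually (gt_mem_nhds ht)).and (Ioo_mem_nhdsGT one_pos)).exists
  obtain ⟨l, hl, h⟩ := hM x hx'
  have h3 := dual_le hτ hg₀ hg₁ hx'.1 hx'.2 hs0 (hs ▸ min_le_left _ _) hl
  have hsd : s ≤ t * d := hs ▸ min_le_right _ _
  have h4 : (t * d - g₀ * s) * l ≤ 0 :=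
    mul_nonpos_of_nonneg_of_nonpos (by nlinarith) hl
  have h5 := hcon l hl
  have h6 := hb0 l hl
  have h7 := mul_le_mul_of_nonneg_left h5 (sub_pos.2 ht1).le
  have h8 := mul_le_mul_of_nonneg_left h6 ht0.le
  nlinarith

/-! ### Chernoff upper bound on the outage probability. -/

/-- The number of channels with feedback `0`, in terms of the squared moduli. -/
noncomputable def numLow (τ : ℝ) {K : ℕ} (y : Fin K → ℝ) : ℝ := ∑ k, if y k ≤ τ then 1 else 0

/-- The total achievable rate, in terms of the squared moduli. -/
noncomputable def gainRate (τ g₀ ρ : ℝ) {K : ℕ} (y : Fin K → ℝ) : ℝ :=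
  ∑ k, if y k ≤ τ then Real.log (1 + g₀ / numLow τ y * ρ * |y k|)
    else Real.log (1 + (1 - g₀) / (K - numLow τ y) * ρ * |y k|)

lemma numLow_eq_card (τ : ℝ) {K : ℕ} (y : Fin K → ℝ) :
    numLow τ y = (Finset.univ.filter fun k => y k ≤ τ).card := by
  simp [numLow]

@[fun_prop]
lemma measurable_numLow (τ : ℝ) (K : ℕ) : Measurable (numLow τ (K := K)) := by
  unfold numLow
  refine Finset.measurable_sum _ fun k _ => Measurable.ite ?_ measurable_const measurable_const
  exact measurableSet_le (measurable_pi_apply k) measurable_const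

@[fun_prop]
lemma measurable_gainRate (τ g₀ ρ : ℝ) (K : ℕ) : Measurable (gainRate τ g₀ ρ (K := K)) := by
  unfold gainRate
  refine Finset.measurable_sum _ fun k _ => Measurable.ite ?_ ?_ ?_
  · exact measurableSet_le (measurable_pi_apply k) measurable_const
  · fun_prop
  · fun_prop

/-- The Chernoff factor of a channel. -/
noncomputable def factor (ρ l κ v y : ℝ) : ℝ :=
  Real.exp (l * (κ / ρ) * Real.log (1 + v / κ * ρ * |y|))

lemma measurable_factor (ρ l κ v : ℝ) : Measurable (factor ρ l κ v) := by
  unfold factor; fun_prop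

lemma factor_le_one {ρ l κ v : ℝ} (hρ : 0 < ρ) (hl : l ≤ 0) (hκ : 0 < κ) (hv : 0 ≤ v) (y : ℝ) :
    factor ρ l κ v y ≤ 1 := by
  rw [factor, Real.exp_le_one_iff, mul_assoc]
  refine mul_nonpos_of_nonpos_of_nonneg hl (mul_nonneg (by positivity) (Real.log_nonneg ?_))
  have : 0 ≤ v / κ * ρ * |y| := by positivity
  linarith

lemma integrable_factor {ρ l κ v : ℝ} (hρ : 0 < ρ) (hl : l ≤ 0) (hκ : 0 < κ) (hv : 0 ≤ v)
    (μ : Measure ℝ) [IsFiniteMeasure μ] : Integrable (factor ρ l κ v) μ :=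
  (integrable_const (1 : ℝ)).mono' (measurable_factor _ _ _ _).aestronglyMeasurable
    (ae_of_all _ fun y => by
      rw [factor, Real.norm_of_nonneg (Real.exp_nonneg _)]; exact factor_le_one hρ hl hκ hv y)

lemma integral_factor_pos {ρ l κ v : ℝ} (hρ : 0 < ρ) (hl : l ≤ 0) (hκ : 0 < κ) (hv : 0 ≤ v)
    {μ : Measure ℝ} [IsFiniteMeasure μ] (hμ : μ ≠ 0) : 0 < ∫ y, factor ρ l κ v y ∂μ := by
  have : NeZero μ := ⟨hμ⟩
  exact integral_exp_pos (integrable_factor hρ hl hκ hv μ)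

/-- The wideband limit: the logarithm is squeezed between `u / (1 + u / κ)` and `u` after
multiplication by `κ`. -/
lemma tendsto_mul_log_one_add_div {ι : Type*} {F : Filter ι} {κ u : ι → ℝ} {w : ℝ}
    (hκ : Tendsto κ F atTop) (hu : Tendsto u F (𝓝 w)) (hu0 : ∀ᶠ i in F, 0 ≤ u i) :
    Tendsto (fun i => κ i * Real.log (1 + u i / κ i)) F (𝓝 w) := by
  have h0 : Tendsto (fun i => u i / κ i) F (𝓝 0) := hu.div_atTop hκ
  have h1 : Tendsto (fun i => u i / (1 + u i / κ i)) F (𝓝 w) := by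
    have h := hu.div (h0.const_add 1) (by simp)
    rwa [add_zero, div_one] at h
  refine tendsto_of_tendsto_of_tendsto_of_le_of_le' h1 hu ?_ ?_
  · filter_upwards [hu0, hκ.eventually_gt_atTop 0] with i hi hk
    have hp : 0 < 1 + u i / κ i := by positivity
    have := Real.one_sub_inv_le_log_of_pos hp
    calc u i / (1 + u i / κ i) = κ i * (1 - (1 + u i / κ i)⁻¹) := by field_simp; ring
      _ ≤ _ := by gcongr
  · filter_upwards [hu0, hκ.eventually_gt_atTop 0] with i hi hk
    have hp : 0 < 1 + u i / κ i := by positivity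
    have := Real.log_le_sub_one_of_pos hp
    calc κ i * Real.log (1 + u i / κ i) ≤ κ i * (u i / κ i) := by gcongr; linarith
      _ = u i := by field_simp

lemma tendsto_integral_factor {ι : Type*} {F : Filter ι} [F.IsCountablyGenerated] {κ v : ι → ℝ}
    {w ρ l : ℝ} (hρ : 0 < ρ) (hl : l ≤ 0) (hκ : Tendsto κ F atTop) (hv : Tendsto v F (𝓝 w))
    (hv0 : ∀ᶠ i in F, 0 ≤ v i) (μ : Measure ℝ) [IsFiniteMeasure μ] :
    Tendsto (fun i => ∫ y, factor ρ l (κ i) (v i) y ∂μ) F (𝓝 (mgf (fun y => |y|) μ (w * l))) := by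
  refine tendsto_integral_filter_of_dominated_convergence (fun _ => 1)
    (Eventually.of_forall fun i => (measurable_factor _ _ _ _).aestronglyMeasurable) ?_
    (integrable_const 1) (ae_of_all _ fun y => ?_)
  · filter_upwards [hv0, hκ.eventually_gt_atTop 0] with i hi hk
    refine ae_of_all _ fun y => ?_
    rw [factor, Real.norm_of_nonneg (Real.exp_nonneg _)]; exact factor_le_one hρ hl hk hi y
  · have hu : Tendsto (fun i => v i * (ρ * |y|)) F (𝓝 (w * (ρ * |y|))) := hv.mul_const _
    have := tendsto_mul_log_one_add_div hκ hu (hv0.mono fun i hi => by positivity)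
    have h2 := (Real.continuous_exp.tendsto _).comp (this.const_mul (l / ρ))
    convert h2 using 2 with i
    · simp only [factor, Function.comp]
      congr 1
      rw [show v i / κ i * ρ * |y| = v i * (ρ * |y|) / κ i by ring]
      ring
    · field_simp

lemma integral_ite_expMeasure {τ : ℝ} {f g : ℝ → ℝ} (hf : Integrable f (lowLaw τ))
    (hg : Integrable g (highLaw τ)) :
    ∫ y, (if y ≤ τ then f y else g y) ∂(expMeasure 1) =
      ∫ y, f y ∂(lowLaw τ) + ∫ y, g y ∂(highLaw τ) := by
  have h := integral_piecewise (μ := expMeasure 1) (measurableSet_Iic (a := τ)) (f := f) (g := g) hf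
    (by rw [Set.compl_Iic]; exact hg)
  rw [Set.compl_Iic] at h
  rw [lowLaw, highLaw, ← h]
  rfl

lemma pow_eq_exp_mul {a : ℝ} {n : ℕ} (h : n = 0 ∨ 0 < a) : a ^ n = Real.exp (n * Real.log a) := by
  rcases h with rfl | h
  · simp
  · rw [Real.exp_nat_mul, Real.exp_log h]

/-- The Chernoff exponent over `κ` channels. -/
noncomputable def chernoffExp (τ g₀ ρ c l κ x : ℝ) : ℝ :=
  l * c - x * Real.log (∫ y, factor ρ l κ (g₀ / x) y ∂(lowLaw τ))
    - (1 - x) * Real.log (∫ y, factor ρ l κ ((1 - g₀) / (1 - x)) y ∂(highLaw τ))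
    - Real.binEntropy x

/-- Markov's inequality for a product of one-channel densities. Giving the two feedback values
masses `x` and `1 - x` produces the entropy term directly, with no estimate of binomial
coefficients. -/
lemma chernoff_bound {τ g₀ ρ c l : ℝ} (hτ : 0 < τ) (hg₀ : 0 ≤ g₀) (hg₁ : g₀ ≤ 1) (hρ : 0 < ρ)
    (hl : l ≤ 0) {K n : ℕ} (hK : 0 < K) (hn : n ≤ K) :
    (Measure.pi fun _ : Fin K => expMeasure 1).real
        {y | numLow τ y = n ∧ gainRate τ g₀ ρ y ≤ ρ * c} ≤
      Real.exp (-(K * chernoffExp τ g₀ ρ c l K (n / K))) := by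
  obtain ⟨x, hx⟩ : ∃ x : ℝ, x = n / K := ⟨_, rfl⟩
  have hK' : (0 : ℝ) < K := by exact_mod_cast hK
  have hx0 : 0 ≤ x := by rw [hx]; positivity
  have hx1 : x ≤ 1 := by rw [hx, div_le_one hK']; exact_mod_cast hn
  have hxK : x * K = n := by rw [hx]; field_simp
  have hv0 : 0 ≤ g₀ / x := by positivity
  have hv1 : 0 ≤ (1 - g₀) / (1 - x) := div_nonneg (by linarith) (by linarith)
  obtain ⟨A, hA⟩ : ∃ A, A = ∫ y, factor ρ l K (g₀ / x) y ∂(lowLaw τ) := ⟨_, rfl⟩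
  obtain ⟨B, hB⟩ : ∃ B, B = ∫ y, factor ρ l K ((1 - g₀) / (1 - x)) y ∂(highLaw τ) := ⟨_, rfl⟩
  have hA0 : 0 < A := hA ▸ integral_factor_pos hρ hl hK' hv0 (lowLaw_ne_zero hτ)
  have hB0 : 0 < B := hB ▸ integral_factor_pos hρ hl hK' hv1 (highLaw_ne_zero hτ)
  have iA := (integrable_factor hρ hl hK' hv0 (lowLaw τ)).const_mul (x / A)
  have iB := (integrable_factor hρ hl hK' hv1 (highLaw τ)).const_mul ((1 - x) / B)
  set f : ℝ → ℝ := fun y => if y ≤ τ then x / A * factor ρ l K (g₀ / x) y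
    else (1 - x) / B * factor ρ l K ((1 - g₀) / (1 - x)) y with hf
  have hf0 : ∀ y, 0 ≤ f y := fun y => by
    simp only [hf]
    have := sub_nonneg.2 hx1
    split_ifs
    · exact mul_nonneg (by positivity) (Real.exp_nonneg _)
    · exact mul_nonneg (by positivity) (Real.exp_nonneg _)
  have hfint : ∫ y, f y ∂(expMeasure 1) = 1 := by
    rw [hf, integral_ite_expMeasure iA iB, integral_const_mul, integral_const_mul, ← hA, ← hB]
    field_simp; ring
  have hfi : Integrable f (expMeasure 1) := by
    by_contra h
    rw [integral_undef h] at hfint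
    exact zero_ne_one hfint
  have hprod : ∫ y : Fin K → ℝ, ∏ k, f (y k) ∂(Measure.pi fun _ : Fin K => expMeasure 1) = 1 := by
    rw [integral_fintype_prod_eq_pow, hfint, one_pow]
  obtain ⟨ε, hε⟩ : ∃ ε, ε = Real.exp (K * chernoffExp τ g₀ ρ c l K x) := ⟨_, rfl⟩
  have hmarkov := mul_meas_ge_le_integral_of_nonneg
    (μ := Measure.pi fun _ : Fin K => expMeasure 1) (f := fun y : Fin K → ℝ => ∏ k, f (y k))
    (ae_of_all _ fun y => Finset.prod_nonneg fun k _ => hf0 _)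
    (Integrable.fintype_prod fun _ => hfi) ε
  rw [hprod] at hmarkov
  have hsub : {y : Fin K → ℝ | numLow τ y = n ∧ gainRate τ g₀ ρ y ≤ ρ * c} ⊆
      {y | ε ≤ ∏ k, f (y k)} := by
    rintro y ⟨hy, hr⟩
    simp only [Set.mem_ofPred_eq]
    have hfk : ∀ k, f (y k) = (if y k ≤ τ then x / A else (1 - x) / B) *
        Real.exp (l * (K / ρ) * (if y k ≤ τ then Real.log (1 + g₀ / numLow τ y * ρ * |y k|)
          else Real.log (1 + (1 - g₀) / (K - numLow τ y) * ρ * |y k|))) := fun k => by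
      simp only [hf]
      have e0 : g₀ / x / K = g₀ / numLow τ y := by rw [hy, ← hxK, div_div]
      have e1 : (1 - g₀) / (1 - x) / K = (1 - g₀) / (K - numLow τ y) := by
        rw [hy, ← hxK, div_div]; congr 1; ring
      split_ifs
      · rw [factor, e0]
      · rw [factor, e1]
    have hcard : (Finset.univ.filter fun k => y k ≤ τ).card = n := by
      rw [numLow_eq_card] at hy; exact_mod_cast hy
    have hcard' : (Finset.univ.filter fun k => ¬ y k ≤ τ).card = K - n := by
      have := Finset.card_filter_add_card_filter_not (s := (Finset.univ : Finset (Fin K)))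
        (fun k => y k ≤ τ)
      rw [hcard, Finset.card_univ, Fintype.card_fin] at this
      omega
    simp_rw [hfk]
    rw [Finset.prod_mul_distrib, Finset.prod_ite, Finset.prod_const, Finset.prod_const, hcard,
      hcard', ← Real.exp_sum, ← Finset.mul_sum]
    change ε ≤ (x / A) ^ n * ((1 - x) / B) ^ (K - n) *
      Real.exp (l * (K / ρ) * gainRate τ g₀ ρ y)
    -- Where a base is zero its exponent is zero too, so the powers can be written as exponentials
    -- despite `Real.log 0 = 0`.
    have h0 : n = 0 ∨ 0 < x := by
      rcases Nat.eq_zero_or_pos n with h | h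
      · exact Or.inl h
      · right; rw [hx]; positivity
    have h1 : K - n = 0 ∨ 0 < 1 - x := by
      rcases hn.lt_or_eq with h | h
      · right
        rw [hx, sub_pos, div_lt_one hK']; exact_mod_cast h
      · left; omega
    have hnK : ((K - n : ℕ) : ℝ) = K - n := Nat.cast_sub hn
    rw [div_pow, div_pow, pow_eq_exp_mul h0, pow_eq_exp_mul h1, pow_eq_exp_mul (Or.inr hA0),
      pow_eq_exp_mul (Or.inr hB0), ← Real.exp_sub, ← Real.exp_sub, ← Real.exp_add, ← Real.exp_add,
      hε, Real.exp_le_exp, chernoffExp, ← hA, ← hB, hnK, ← hxK,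
      Real.binEntropy_eq_negMulLog_add_negMulLog_one_sub, Real.negMulLog, Real.negMulLog]
    have hR : l * (K / ρ) * (ρ * c) ≤ l * (K / ρ) * gainRate τ g₀ ρ y :=
      mul_le_mul_of_nonpos_left hr (mul_nonpos_of_nonpos_of_nonneg hl (by positivity))
    have e : l * (K / ρ) * (ρ * c) = K * (l * c) := by field_simp
    rw [e] at hR
    linarith
  have := (mul_le_mul_of_nonneg_left (measureReal_mono hsub) (hε ▸ Real.exp_nonneg _)).trans hmarkov
  rw [← hx, Real.exp_neg, ← hε, ← one_div, le_div_iff₀ (hε ▸ Real.exp_pos _), mul_comm]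
  exact this

/-- The Chernoff exponent near every fraction of channels with feedback `0`. -/
lemma eventually_lt_chernoffExp {τ g₀ ρ c M : ℝ} (hτ : 0 < τ) (hg₀ : 0 ≤ g₀) (hg₁ : g₀ ≤ 1)
    (hρ : 0 < ρ) (hc : 0 < c) (hM : ∀ x ∈ Set.Ioc (0 : ℝ) 1, ∃ l ≤ 0, M < dual τ g₀ x l + l * c)
    {M' : ℝ} (hM' : M' < M) {x : ℝ} (hx0 : 0 ≤ x) (hx1 : x ≤ 1) :
    ∃ l ≤ 0, ∀ᶠ p : ℕ × ℝ in atTop ×ˢ 𝓝 x, p.2 ∈ Set.Icc (0 : ℝ) 1 →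
      M' < chernoffExp τ g₀ ρ c l p.1 p.2 := by
  have hκ : Tendsto (fun p : ℕ × ℝ => (p.1 : ℝ)) (atTop ×ˢ (𝓝 x ⊓ 𝓟 (Set.Icc 0 1))) atTop :=
    tendsto_natCast_atTop_atTop.comp tendsto_fst
  have hX : Tendsto (fun p : ℕ × ℝ => p.2) (atTop ×ˢ (𝓝 x ⊓ 𝓟 (Set.Icc 0 1))) (𝓝 x) :=
    tendsto_snd.mono_right inf_le_left
  have hI : ∀ᶠ p : ℕ × ℝ in atTop ×ˢ (𝓝 x ⊓ 𝓟 (Set.Icc 0 1)), p.2 ∈ Set.Icc (0 : ℝ) 1 :=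
    tendsto_snd.eventually (eventually_inf_principal.2 (Eventually.of_forall fun _ h => h))
  have hκ0 := hκ.eventually_gt_atTop 0
  have hent := (Real.binEntropy_continuous.tendsto x).comp hX
  -- At `x = 0` the argument `g₀ / p.2` need not converge. The sign of the term is then enough,
  -- because dropping it only lowers the exponent; `high_le` plays this role at `x = 1`.
  have low_le : ∀ l ≤ 0, ∀ᶠ p : ℕ × ℝ in atTop ×ˢ (𝓝 x ⊓ 𝓟 (Set.Icc 0 1)),
      p.2 * Real.log (∫ y, factor ρ l p.1 (g₀ / p.2) y ∂(lowLaw τ)) ≤ 0 := fun l hl => by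
    filter_upwards [hI, hκ0] with p hp hk
    refine mul_nonpos_of_nonneg_of_nonpos hp.1 (Real.log_nonpos
      (integral_nonneg fun y => Real.exp_nonneg _) ?_)
    have hv : 0 ≤ g₀ / p.2 := div_nonneg hg₀ hp.1
    calc ∫ y, factor ρ l p.1 (g₀ / p.2) y ∂(lowLaw τ)
        ≤ ∫ y, factor ρ l p.1 (g₀ / p.2) y ∂(expMeasure 1) :=
          integral_mono_measure Measure.restrict_le_self (ae_of_all _ fun y => Real.exp_nonneg _)
            (integrable_factor hρ hl hk hv _)
      _ ≤ ∫ y, (1 : ℝ) ∂(expMeasure 1) := integral_mono (integrable_factor hρ hl hk hv _)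
          (integrable_const _) fun y => factor_le_one hρ hl hk hv y
      _ = 1 := by simp
  have high_le : ∀ l ≤ 0, ∀ᶠ p : ℕ × ℝ in atTop ×ˢ (𝓝 x ⊓ 𝓟 (Set.Icc 0 1)),
      (1 - p.2) * Real.log (∫ y, factor ρ l p.1 ((1 - g₀) / (1 - p.2)) y ∂(highLaw τ)) ≤ 0 :=
      fun l hl => by
    filter_upwards [hI, hκ0] with p hp hk
    refine mul_nonpos_of_nonneg_of_nonpos (by linarith [hp.2]) (Real.log_nonpos
      (integral_nonneg fun y => Real.exp_nonneg _) ?_)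
    have hv : 0 ≤ (1 - g₀) / (1 - p.2) := div_nonneg (by linarith) (by linarith [hp.2])
    calc ∫ y, factor ρ l p.1 ((1 - g₀) / (1 - p.2)) y ∂(highLaw τ)
        ≤ ∫ y, factor ρ l p.1 ((1 - g₀) / (1 - p.2)) y ∂(expMeasure 1) :=
          integral_mono_measure Measure.restrict_le_self (ae_of_all _ fun y => Real.exp_nonneg _)
            (integrable_factor hρ hl hk hv _)
      _ ≤ ∫ y, (1 : ℝ) ∂(expMeasure 1) := integral_mono (integrable_factor hρ hl hk hv _)
          (integrable_const _) fun y => factor_le_one hρ hl hk hv y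
      _ = 1 := by simp
  have low_lim : ∀ l ≤ 0, 0 < x → Tendsto (fun p : ℕ × ℝ =>
      p.2 * Real.log (∫ y, factor ρ l p.1 (g₀ / p.2) y ∂(lowLaw τ)))
      (atTop ×ˢ (𝓝 x ⊓ 𝓟 (Set.Icc 0 1))) (𝓝 (x * lowCgf τ (g₀ / x * l))) := fun l hl h => by
    have hv0 : ∀ᶠ p : ℕ × ℝ in atTop ×ˢ (𝓝 x ⊓ 𝓟 (Set.Icc 0 1)), 0 ≤ g₀ / p.2 := by
      filter_upwards [hI] with p hp using div_nonneg hg₀ hp.1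
    have := tendsto_integral_factor hρ hl hκ
      (tendsto_const_nhds.div hX h.ne' : Tendsto (fun p : ℕ × ℝ => g₀ / p.2) _ _) hv0 (lowLaw τ)
    refine hX.mul (this.log (mgf_pos' (lowLaw_ne_zero hτ) ?_).ne')
    have hθ := low_param_nonpos hg₀ h.le hl
    exact (integrable_exp_mul_abs_expMeasure (hθ.trans_lt one_pos)).mono_measure
      Measure.restrict_le_self
  have high_lim : ∀ l ≤ 0, x < 1 → Tendsto (fun p : ℕ × ℝ =>
      (1 - p.2) * Real.log (∫ y, factor ρ l p.1 ((1 - g₀) / (1 - p.2)) y ∂(highLaw τ)))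
      (atTop ×ˢ (𝓝 x ⊓ 𝓟 (Set.Icc 0 1)))
      (𝓝 ((1 - x) * highCgf τ ((1 - g₀) / (1 - x) * l))) := fun l hl h => by
    have hv0 : ∀ᶠ p : ℕ × ℝ in atTop ×ˢ (𝓝 x ⊓ 𝓟 (Set.Icc 0 1)),
        0 ≤ (1 - g₀) / (1 - p.2) := by
      filter_upwards [hI] with p hp using div_nonneg (by linarith) (by linarith [hp.2])
    have hX' : Tendsto (fun p : ℕ × ℝ => 1 - p.2) (atTop ×ˢ (𝓝 x ⊓ 𝓟 (Set.Icc 0 1)))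
      (𝓝 (1 - x)) := hX.const_sub 1
    have := tendsto_integral_factor hρ hl hκ
      (tendsto_const_nhds.div hX' (sub_pos.2 h).ne' :
        Tendsto (fun p : ℕ × ℝ => (1 - g₀) / (1 - p.2)) _ _) hv0 (highLaw τ)
    refine hX'.mul (this.log (mgf_pos' (highLaw_ne_zero hτ) ?_).ne')
    have hθ := high_param_nonpos hg₁ hx1 hl
    exact (integrable_exp_mul_abs_expMeasure (hθ.trans_lt one_pos)).mono_measure
      Measure.restrict_le_self
  have conv : ∀ l, (∀ᶠ p : ℕ × ℝ in atTop ×ˢ (𝓝 x ⊓ 𝓟 (Set.Icc 0 1)),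
      M' < chernoffExp τ g₀ ρ c l p.1 p.2) → ∀ᶠ p : ℕ × ℝ in atTop ×ˢ 𝓝 x,
      p.2 ∈ Set.Icc (0 : ℝ) 1 → M' < chernoffExp τ g₀ ρ c l p.1 p.2 := fun l h => by
    have e : Tendsto id ((atTop ×ˢ 𝓝 x) ⊓ 𝓟 {p : ℕ × ℝ | p.2 ∈ Set.Icc (0 : ℝ) 1})
        (atTop ×ˢ (𝓝 x ⊓ 𝓟 (Set.Icc 0 1))) :=
      (tendsto_fst.mono_left inf_le_left).prodMk (tendsto_inf.2
        ⟨tendsto_snd.mono_left inf_le_left, tendsto_principal.2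
          (eventually_inf_principal.2 (Eventually.of_forall fun _ h => h))⟩)
    exact eventually_inf_principal.1 (e.eventually h)
  rcases hx0.eq_or_lt with rfl | h0
  · obtain ⟨l, hl, h⟩ := exists_lt_highCgf hτ hg₀ hg₁ hc
      (fun x hx => hM x (Set.Ioo_subset_Ioc_self hx)) hM'
    refine ⟨l, hl, conv l ?_⟩
    have lim := ((high_lim l hl one_pos).const_sub (l * c)).sub hent
    simp only [sub_zero, div_one, one_mul, Real.binEntropy_zero] at lim
    filter_upwards [lim.eventually (lt_mem_nhds (by linarith : M' < _)), low_le l hl] with p hp h1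
    simp only [Function.comp] at hp
    rw [chernoffExp]; linarith
  rcases hx1.eq_or_lt with rfl | h1
  · obtain ⟨l, hl, h⟩ := hM 1 (by simp)
    refine ⟨l, hl, conv l ?_⟩
    have lim := ((low_lim l hl one_pos).const_sub (l * c)).sub hent
    simp only [dual, sub_self, zero_mul, sub_zero, Real.binEntropy_one] at lim h
    filter_upwards [lim.eventually (lt_mem_nhds (by linarith : M' < _)), high_le l hl] with p hp h1
    simp only [Function.comp] at hp
    rw [chernoffExp]; linarith
  · obtain ⟨l, hl, h⟩ := hM x ⟨h0, hx1⟩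
    refine ⟨l, hl, conv l ?_⟩
    have lim := (((low_lim l hl h0).const_sub (l * c)).sub (high_lim l hl h1)).sub hent
    rw [dual] at h
    filter_upwards [lim.eventually (lt_mem_nhds (by linarith : M' < _))] with p hp
    exact hp

/-! ### Lower bound on the outage probability: tilting and the law of large numbers. -/

/-- The weak law of large numbers on finite product spaces. -/
lemma tendsto_pi_deviation {E : Type*} [MeasurableSpace E] (ν : Measure E) [IsProbabilityMeasure ν]
    {f : E → ℝ} (hf : MemLp f 2 ν) {δ : ℝ} (hδ : 0 < δ) :
    Tendsto (fun K : ℕ => (Measure.pi fun _ : Fin K => ν)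
      {y | δ ≤ |(∑ k, f (y k)) / K - ∫ z, f z ∂ν|}) atTop (𝓝 0) := by
  have hlim : Tendsto (fun K : ℕ => ENNReal.ofReal (Var[f; ν] / δ ^ 2 / K)) atTop (𝓝 0) := by
    have := (tendsto_const_div_atTop_nhds_zero_nat (Var[f; ν] / δ ^ 2))
    simpa using ENNReal.tendsto_ofReal this
  refine tendsto_of_tendsto_of_tendsto_of_le_of_le' tendsto_const_nhds hlim
    (Eventually.of_forall fun _ => bot_le) ?_
  filter_upwards [eventually_gt_atTop 0] with K hK
  have hK' : (0 : ℝ) < K := by exact_mod_cast hK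
  have hfk : ∀ k : Fin K, MemLp (fun y : Fin K → E => f (y k)) 2 (Measure.pi fun _ : Fin K => ν) :=
    fun k => hf.comp_measurePreserving (measurePreserving_eval (fun _ : Fin K => ν) k)
  have hint : ∫ y : Fin K → E, ∑ k, f (y k) ∂(Measure.pi fun _ : Fin K => ν) =
      K * ∫ z, f z ∂ν := by
    rw [integral_finsetSum _ fun k _ => (hfk k).integrable (by norm_num)]
    have : ∀ k : Fin K, ∫ y : Fin K → E, f (y k) ∂(Measure.pi fun _ : Fin K => ν) = ∫ z, f z ∂ν :=
      fun k => integral_comp_eval (μ := fun _ : Fin K => ν) hf.aestronglyMeasurable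
    simp [this]
  have hvar : Var[fun y : Fin K → E => ∑ k, f (y k); Measure.pi fun _ : Fin K => ν] =
      K * Var[f; ν] := by
    have := variance_sum_pi (μ := fun _ : Fin K => ν) (X := fun _ => f) fun _ => hf
    rw [Finset.sum_const, Finset.card_univ, Fintype.card_fin, nsmul_eq_mul] at this
    rw [← this]
    congr 1 with y
    simp
  have hcheb := meas_ge_le_variance_div_sq (memLp_finsetSum Finset.univ fun k _ => hfk k)
    (c := δ * K) (by positivity)
  rw [hint, hvar] at hcheb
  refine (measure_mono fun y hy => ?_).trans (hcheb.trans (le_of_eq ?_))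
  · simp only [Set.mem_ofPred_eq] at hy ⊢
    have e : (∑ k, f (y k)) - K * ∫ z, f z ∂ν = ((∑ k, f (y k)) / K - ∫ z, f z ∂ν) * K := by
      field_simp
    rw [e, abs_mul, abs_of_pos hK']
    gcongr
  · congr 1; field_simp

/-- The density of a product of measures with densities. -/
lemma pi_withDensity {E : Type*} [MeasurableSpace E] (ν : Measure E) [IsProbabilityMeasure ν]
    {q : E → ENNReal} (hq : Measurable q) [IsProbabilityMeasure (ν.withDensity q)] (K : ℕ) :
    Measure.pi (fun _ : Fin K => ν.withDensity q) =
      (Measure.pi fun _ : Fin K => ν).withDensity fun y => ∏ k, q (y k) := by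
  refine Measure.pi_eq fun s hs => ?_
  have hm : ∀ k, Measurable ((s k).indicator q) := fun k => hq.indicator (hs k)
  have hind : iIndepFun (fun k (y : Fin K → E) => (s k).indicator q (y k))
      (Measure.pi fun _ : Fin K => ν) :=
    iIndepFun_pi (μ := fun _ : Fin K => ν) (X := fun k => (s k).indicator q)
      fun k => (hm k).aemeasurable
  rw [withDensity_apply _ (MeasurableSet.univ_pi hs),
    ← lintegral_indicator (MeasurableSet.univ_pi hs)]
  have h1 : ∀ y : Fin K → E, (Set.pi Set.univ s).indicator (fun y => ∏ k, q (y k)) y =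
      ∏ k, (s k).indicator q (y k) := fun y => by
    by_cases hy : y ∈ Set.pi Set.univ s
    · rw [Set.indicator_of_mem hy]
      exact Finset.prod_congr rfl fun k _ => (Set.indicator_of_mem (hy k (Set.mem_univ k)) _).symm
    · rw [Set.indicator_of_notMem hy]
      obtain ⟨k, hk⟩ : ∃ k, y k ∉ s k := by simpa [Set.mem_pi] using hy
      exact (Finset.prod_eq_zero (Finset.mem_univ k) (Set.indicator_of_notMem hk _)).symm
  simp_rw [h1]
  rw [lintegral_prod_eq_prod_lintegral_of_indepFun Finset.univ
    (fun k (y : Fin K → E) => (s k).indicator q (y k)) hind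
    fun k => (hm k).comp (measurable_pi_apply k)]
  refine Finset.prod_congr rfl fun k _ => ?_
  rw [withDensity_apply _ (hs k), ← lintegral_indicator (hs k)]
  exact (measurePreserving_eval (fun _ : Fin K => ν) k).lintegral_comp (hm k)

/-- The tilted law of a channel: feedback `0` with probability `x`, and exponential tilts given
the feedback. -/
noncomputable def tiltedLaw (τ x θ₀ θ₁ : ℝ) : Measure ℝ :=
  ENNReal.ofReal x • (lowLaw τ).tilted (fun y => θ₀ * |y|) +
    ENNReal.ofReal (1 - x) • (highLaw τ).tilted (fun y => θ₁ * |y|)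

/-- The density of the tilted law. -/
noncomputable def tiltedDensity (τ x θ₀ θ₁ y : ℝ) : ENNReal :=
  if y ≤ τ then ENNReal.ofReal (x * (Real.exp (θ₀ * |y|) / mgf (fun y => |y|) (lowLaw τ) θ₀))
  else ENNReal.ofReal ((1 - x) * (Real.exp (θ₁ * |y|) / mgf (fun y => |y|) (highLaw τ) θ₁))

section
variable {τ x θ₀ θ₁ : ℝ}

lemma measurable_tiltedDensity : Measurable (tiltedDensity τ x θ₀ θ₁) := by
  unfold tiltedDensity
  refine Measurable.ite measurableSet_Iic ?_ ?_ <;> fun_prop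

lemma withDensity_tiltedDensity (hx0 : 0 ≤ x) (hx1 : x ≤ 1) :
    (expMeasure 1).withDensity (tiltedDensity τ x θ₀ θ₁) = tiltedLaw τ x θ₀ θ₁ := by
  have e : tiltedDensity τ x θ₀ θ₁ =
      (Set.Iic τ).indicator (ENNReal.ofReal x • fun y =>
        ENNReal.ofReal (Real.exp (θ₀ * |y|) / ∫ y, Real.exp (θ₀ * |y|) ∂(lowLaw τ))) +
      (Set.Ioi τ).indicator (ENNReal.ofReal (1 - x) • fun y =>
        ENNReal.ofReal (Real.exp (θ₁ * |y|) / ∫ y, Real.exp (θ₁ * |y|) ∂(highLaw τ))) := by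
    ext y
    by_cases hy : y ≤ τ
    · simp [tiltedDensity, hy, ENNReal.ofReal_mul hx0, mgf]
    · simp [tiltedDensity, hy, not_le.1 hy, ENNReal.ofReal_mul (sub_nonneg.2 hx1), mgf]
  have m0 : Measurable (fun y : ℝ =>
      ENNReal.ofReal (Real.exp (θ₀ * |y|) / ∫ y, Real.exp (θ₀ * |y|) ∂(lowLaw τ))) := by fun_prop
  have m1 : Measurable (fun y : ℝ =>
      ENNReal.ofReal (Real.exp (θ₁ * |y|) / ∫ y, Real.exp (θ₁ * |y|) ∂(highLaw τ))) := by fun_prop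
  rw [e, withDensity_add_left ((m0.const_smul _).indicator measurableSet_Iic),
    withDensity_indicator measurableSet_Iic, withDensity_indicator measurableSet_Ioi,
    withDensity_smul _ m0, withDensity_smul _ m1]
  rfl

/-- Only an inequality, because at `x = 1` the density vanishes above `τ` while the convention
`Real.log 0 = 0` keeps the right-hand side positive. -/
lemma tiltedDensity_le (hτ : 0 < τ) (hx0 : 0 < x) (hx1 : x ≤ 1) (h0 : θ₀ < 1) (h1 : θ₁ < 1)
    (y : ℝ) : tiltedDensity τ x θ₀ θ₁ y ≤ ENNReal.ofReal (Real.exp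
      (if y ≤ τ then Real.log x - lowCgf τ θ₀ + θ₀ * |y|
        else Real.log (1 - x) - highCgf τ θ₁ + θ₁ * |y|)) := by
  have i0 : Integrable (fun y => Real.exp (θ₀ * |y|)) (lowLaw τ) :=
    (integrable_exp_mul_abs_expMeasure h0).mono_measure Measure.restrict_le_self
  have i1 : Integrable (fun y => Real.exp (θ₁ * |y|)) (highLaw τ) :=
    (integrable_exp_mul_abs_expMeasure h1).mono_measure Measure.restrict_le_self
  have : NeZero (lowLaw τ) := ⟨lowLaw_ne_zero hτ⟩
  have : NeZero (highLaw τ) := ⟨highLaw_ne_zero hτ⟩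
  unfold tiltedDensity
  split_ifs
  · refine ENNReal.ofReal_le_ofReal (le_of_eq ?_)
    rw [Real.exp_add, Real.exp_sub, Real.exp_log hx0, lowCgf,
      exp_cgf i0]
    ring
  · refine ENNReal.ofReal_le_ofReal ?_
    rcases hx1.eq_or_lt with rfl | hx
    · simp [Real.exp_nonneg]
    rw [Real.exp_add, Real.exp_sub, Real.exp_log (sub_pos.2 hx), highCgf,
      exp_cgf i1]
    exact le_of_eq (by ring)

lemma isProbabilityMeasure_low_tilted (hτ : 0 < τ) (h0 : θ₀ < 1) :
    IsProbabilityMeasure ((lowLaw τ).tilted fun y => θ₀ * |y|) := by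
  have : NeZero (lowLaw τ) := ⟨lowLaw_ne_zero hτ⟩
  exact isProbabilityMeasure_tilted
    ((integrable_exp_mul_abs_expMeasure h0).mono_measure Measure.restrict_le_self)

lemma isProbabilityMeasure_high_tilted (hτ : 0 < τ) (h1 : θ₁ < 1) :
    IsProbabilityMeasure ((highLaw τ).tilted fun y => θ₁ * |y|) := by
  have : NeZero (highLaw τ) := ⟨highLaw_ne_zero hτ⟩
  exact isProbabilityMeasure_tilted
    ((integrable_exp_mul_abs_expMeasure h1).mono_measure Measure.restrict_le_self)

lemma isProbabilityMeasure_tiltedLaw (hτ : 0 < τ) (hx0 : 0 ≤ x) (hx1 : x ≤ 1) (h0 : θ₀ < 1)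
    (h1 : θ₁ < 1) : IsProbabilityMeasure (tiltedLaw τ x θ₀ θ₁) := by
  have := isProbabilityMeasure_low_tilted hτ h0
  have := isProbabilityMeasure_high_tilted hτ h1
  constructor
  simp only [tiltedLaw, Measure.coe_add, Measure.coe_smul, Pi.add_apply, Pi.smul_apply,
    measure_univ, smul_eq_mul, mul_one]
  rw [← ENNReal.ofReal_add hx0 (sub_nonneg.2 hx1)]
  simp

lemma ae_low_tilted : ∀ᵐ y ∂((lowLaw τ).tilted fun y => θ₀ * |y|), y ≤ τ :=
  (tilted_absolutelyContinuous _ _).ae_le (ae_restrict_mem measurableSet_Iic)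

lemma ae_high_tilted : ∀ᵐ y ∂((highLaw τ).tilted fun y => θ₁ * |y|), ¬ y ≤ τ := by
  have : ∀ᵐ y ∂(highLaw τ), y ∈ Set.Ioi τ := ae_restrict_mem measurableSet_Ioi
  filter_upwards [(tilted_absolutelyContinuous _ _).ae_le this] with y hy using not_le.2 hy

/-- A function given separately for the two values of the feedback has a second moment under the
tilted law, and its mean is the mixture of the conditional ones. -/
lemma memLp_ite_tiltedLaw {f g : ℝ → ℝ}
    (hf : MemLp f 2 ((lowLaw τ).tilted fun y => θ₀ * |y|))
    (hg : MemLp g 2 ((highLaw τ).tilted fun y => θ₁ * |y|)) :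
    MemLp (fun y => if y ≤ τ then f y else g y) 2 (tiltedLaw τ x θ₀ θ₁) := by
  have hf' : MemLp (fun y => if y ≤ τ then f y else g y) 2
      ((lowLaw τ).tilted fun y => θ₀ * |y|) :=
    hf.ae_eq (by filter_upwards [ae_low_tilted] with y hy; simp [hy])
  have hg' : MemLp (fun y => if y ≤ τ then f y else g y) 2
      ((highLaw τ).tilted fun y => θ₁ * |y|) :=
    hg.ae_eq (by filter_upwards [ae_high_tilted] with y hy; simp [hy])
  have hf2 := hf'.smul_measure (ENNReal.ofReal_ne_top (r := x))
  have hg2 := hg'.smul_measure (ENNReal.ofReal_ne_top (r := 1 - x))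
  have hm := hf2.aestronglyMeasurable.add_measure hg2.aestronglyMeasurable
  exact (memLp_two_iff_integrable_sq hm).2 (hf2.integrable_sq.add_measure hg2.integrable_sq)

lemma integral_ite_tiltedLaw (hτ : 0 < τ) (h0 : θ₀ < 1) (h1 : θ₁ < 1) (hx0 : 0 ≤ x) (hx1 : x ≤ 1)
    {f g : ℝ → ℝ}
    (hf : MemLp f 2 ((lowLaw τ).tilted fun y => θ₀ * |y|))
    (hg : MemLp g 2 ((highLaw τ).tilted fun y => θ₁ * |y|)) :
    ∫ y, (if y ≤ τ then f y else g y) ∂(tiltedLaw τ x θ₀ θ₁) =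
      x * ∫ y, f y ∂((lowLaw τ).tilted fun y => θ₀ * |y|) +
      (1 - x) * ∫ y, g y ∂((highLaw τ).tilted fun y => θ₁ * |y|) := by
  have := isProbabilityMeasure_low_tilted hτ h0
  have := isProbabilityMeasure_high_tilted hτ h1
  have ef : f =ᵐ[(lowLaw τ).tilted fun y => θ₀ * |y|] fun y => if y ≤ τ then f y else g y := by
    filter_upwards [ae_low_tilted] with y hy; simp [hy]
  have eg : g =ᵐ[(highLaw τ).tilted fun y => θ₁ * |y|] fun y => if y ≤ τ then f y else g y := by
    filter_upwards [ae_high_tilted] with y hy; simp [hy]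
  have i0 := (((hf.integrable (by norm_num)).congr ef).smul_measure
    (ENNReal.ofReal_ne_top (r := x)))
  have i1 := (((hg.integrable (by norm_num)).congr eg).smul_measure
    (ENNReal.ofReal_ne_top (r := 1 - x)))
  rw [tiltedLaw, integral_add_measure i0 i1, integral_smul_measure, integral_smul_measure,
    ← integral_congr_ae ef, ← integral_congr_ae eg, ENNReal.toReal_ofReal hx0,
    ENNReal.toReal_ofReal (sub_nonneg.2 hx1)]
  rfl

end

/-- The fraction of channels with feedback `0`, and the averages of the squared moduli over each
kind of channel, normalized by the number of channels. -/
noncomputable def averages (τ : ℝ) {K : ℕ} (y : Fin K → ℝ) : ℝ × ℝ × ℝ :=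
  ((∑ k, if y k ≤ τ then 1 else 0) / K, (∑ k, if y k ≤ τ then |y k| else 0) / K,
    (∑ k, if y k ≤ τ then 0 else |y k|) / K)

/-- Three applications of the weak law and a union bound; the tilted means are derivatives of the
cumulant generating functions. Probability one half is all that the change of measure needs. -/
lemma eventually_averages {τ x θ₀ θ₁ : ℝ} (hτ : 0 < τ) (hx0 : 0 ≤ x) (hx1 : x ≤ 1) (h0 : θ₀ < 1)
    (h1 : θ₁ < 1) {P : ℝ × ℝ × ℝ → Prop}
    (hP : ∀ᶠ v in 𝓝 (x, x * deriv (lowCgf τ) θ₀, (1 - x) * deriv (highCgf τ) θ₁), P v) :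
    ∀ᶠ K : ℕ in atTop, (Measure.pi fun _ : Fin K => tiltedLaw τ x θ₀ θ₁)
      {y | ¬ P (averages τ y)} ≤ ENNReal.ofReal (1 / 2) := by
  have := isProbabilityMeasure_tiltedLaw hτ hx0 hx1 h0 h1
  have := isProbabilityMeasure_low_tilted hτ h0
  have := isProbabilityMeasure_high_tilted hτ h1
  have a0 : MemLp (fun y : ℝ => |y|) 2 ((lowLaw τ).tilted fun y => θ₀ * |y|) :=
    memLp_tilted_mul (mem_interior_lowLaw h0) 2
  have a1 : MemLp (fun y : ℝ => |y|) 2 ((highLaw τ).tilted fun y => θ₁ * |y|) :=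
    memLp_tilted_mul (mem_interior_highLaw h1) 2
  have m0 := integral_tilted_mul_self (mem_interior_lowLaw (τ := τ) h0)
  have m1 := integral_tilted_mul_self (mem_interior_highLaw (τ := τ) h1)
  have c0 (r : ℝ) : MemLp (fun _ => r) 2 ((lowLaw τ).tilted fun y => θ₀ * |y|) := memLp_const r
  have c1 (r : ℝ) : MemLp (fun _ => r) 2 ((highLaw τ).tilted fun y => θ₁ * |y|) := memLp_const r
  have e0 := integral_ite_tiltedLaw hτ h0 h1 hx0 hx1 (c0 1) (c1 0)
  have e1 := integral_ite_tiltedLaw hτ h0 h1 hx0 hx1 a0 (c1 0)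
  have e2 := integral_ite_tiltedLaw hτ h0 h1 hx0 hx1 (c0 0) a1
  rw [m0] at e1
  rw [m1] at e2
  simp only [integral_const, probReal_univ, smul_eq_mul, mul_one, mul_zero, add_zero,
    zero_add] at e0 e1 e2
  obtain ⟨δ, hδ, hball⟩ := Metric.eventually_nhds_iff.1 hP
  have t0 := tendsto_pi_deviation _ (memLp_ite_tiltedLaw (x := x) (c0 1) (c1 0)) hδ
  have t1 := tendsto_pi_deviation _ (memLp_ite_tiltedLaw (x := x) a0 (c1 0)) hδ
  have t2 := tendsto_pi_deviation _ (memLp_ite_tiltedLaw (x := x) (c0 0) a1) hδ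
  rw [e0] at t0
  rw [e1] at t1
  rw [e2] at t2
  have t := (t0.add t1).add t2
  simp only [add_zero] at t
  filter_upwards [t.eventually (ge_mem_nhds (by simp : (0 : ENNReal) < ENNReal.ofReal (1 / 2)))]
    with K hK
  refine le_trans (le_trans (measure_mono ?_) ((measure_union_le _ _).trans
    (add_le_add_left (measure_union_le _ _) _))) hK
  intro y hy
  by_contra hcon
  simp only [Set.mem_union, Set.mem_ofPred_eq, not_or, not_le] at hcon
  refine hy (hball ?_)
  rw [Prod.dist_eq, Prod.dist_eq, Real.dist_eq, Real.dist_eq, Real.dist_eq]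
  exact max_lt hcon.1.1 (max_lt hcon.1.2 hcon.2)

/-- By `log (1 + t) ≤ t`, the outage event contains the event that the linearized rate is small, for
every `K > 0`. -/
lemma gainRate_le {τ g₀ ρ : ℝ} (hg₀ : 0 ≤ g₀) (hg₁ : g₀ ≤ 1) (hρ : 0 < ρ) {K : ℕ} (hK : 0 < K)
    (y : Fin K → ℝ) : gainRate τ g₀ ρ y ≤
      ρ * (g₀ / (averages τ y).1 * (averages τ y).2.1 +
        (1 - g₀) / (1 - (averages τ y).1) * (averages τ y).2.2) := by
  have hK' : (0 : ℝ) < K := by exact_mod_cast hK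
  have hn0 : 0 ≤ numLow τ y := Finset.sum_nonneg fun k _ => by split_ifs <;> simp
  have hn1 : 0 ≤ K - numLow τ y := by
    rw [sub_nonneg, numLow_eq_card]
    exact_mod_cast (Finset.card_filter_le _ _).trans (by simp)
  have hlog : ∀ t : ℝ, 0 ≤ t → Real.log (1 + t) ≤ t := fun t ht => by
    have := Real.log_le_sub_one_of_pos (x := 1 + t) (by linarith)
    linarith
  calc gainRate τ g₀ ρ y
      ≤ ∑ k, (g₀ / numLow τ y * ρ * (if y k ≤ τ then |y k| else 0) +
          (1 - g₀) / (K - numLow τ y) * ρ * (if y k ≤ τ then 0 else |y k|)) := by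
        refine Finset.sum_le_sum fun k _ => ?_
        have := sub_nonneg.2 hg₁
        split_ifs
        · simpa using hlog _ (by positivity)
        · simpa using hlog _ (by positivity)
    _ = _ := by
        rw [Finset.sum_add_distrib, ← Finset.mul_sum, ← Finset.mul_sum]
        change _ = ρ * (g₀ / (numLow τ y / K) * (_ / K) + (1 - g₀) / (1 - numLow τ y / K) * (_ / K))
        have e : 1 - numLow τ y / K = (K - numLow τ y) / K := by field_simp
        rw [e, div_div_eq_mul_div, div_div_eq_mul_div]
        field_simp

/-- At `x = 1` the coefficient `(1 - g₀) / (1 - v)` has no continuity at `v = 1`; exact vanishing of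
the average replaces the limit. -/
lemma ae_averages_one {τ θ₀ θ₁ : ℝ} (hτ : 0 < τ) (h0 : θ₀ < 1) (h1 : θ₁ < 1) (K : ℕ) :
    ∀ᵐ y ∂(Measure.pi fun _ : Fin K => tiltedLaw τ 1 θ₀ θ₁), (averages τ y).2.2 = 0 := by
  have := isProbabilityMeasure_tiltedLaw hτ zero_le_one le_rfl h0 h1
  have h : ∀ᵐ y ∂(tiltedLaw τ 1 θ₀ θ₁), y ≤ τ := by
    simpa [tiltedLaw] using ae_low_tilted (τ := τ) (θ₀ := θ₀)
  have h' : ∀ᵐ y ∂(Measure.pi fun _ : Fin K => tiltedLaw τ 1 θ₀ θ₁), ∀ k, y k ≤ τ :=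
    ae_all_iff.2 fun k =>
      (Measure.quasiMeasurePreserving_eval (fun _ : Fin K => tiltedLaw τ 1 θ₀ θ₁) k).ae h
  filter_upwards [h'] with y hy
  simp [averages, hy]

/-- Change of measure: a set of tilted probability at least one half, on which the density is at
most `exp (K (D + δ))`, has original probability at least `exp (-K (D + δ)) / 2`. Here `D` is the
relative entropy of the tilted law of one channel. -/
lemma eventually_le_pi_gainRate {τ g₀ ρ c x l δ : ℝ} (hτ : 0 < τ) (hg₀ : 0 ≤ g₀) (hg₁ : g₀ ≤ 1)
    (hρ : 0 < ρ) (hx0 : 0 < x) (hx1 : x ≤ 1) (hl : l ≤ 0) (hc : tiltedMean τ g₀ x l < c)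
    (hδ : 0 < δ) :
    ∀ᶠ K : ℕ in atTop, 1 / 2 * Real.exp (-(K * (dual τ g₀ x l + l * tiltedMean τ g₀ x l + δ))) ≤
      (Measure.pi fun _ : Fin K => expMeasure 1).real {y | gainRate τ g₀ ρ y ≤ ρ * c} := by
  obtain ⟨θ₀, hθ₀⟩ : ∃ θ₀, θ₀ = g₀ / x * l := ⟨_, rfl⟩
  obtain ⟨θ₁, hθ₁⟩ : ∃ θ₁, θ₁ = (1 - g₀) / (1 - x) * l := ⟨_, rfl⟩
  have h0 : θ₀ < 1 := hθ₀ ▸ (low_param_nonpos hg₀ hx0.le hl).trans_lt one_pos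
  have h1 : θ₁ < 1 := hθ₁ ▸ (high_param_nonpos hg₁ hx1 hl).trans_lt one_pos
  obtain ⟨s₀, hs₀⟩ : ∃ s, s = x * deriv (lowCgf τ) θ₀ := ⟨_, rfl⟩
  obtain ⟨s₁, hs₁⟩ : ∃ s, s = (1 - x) * deriv (highCgf τ) θ₁ := ⟨_, rfl⟩
  obtain ⟨D, hD⟩ : ∃ D, D = dual τ g₀ x l + l * tiltedMean τ g₀ x l := ⟨_, rfl⟩
  -- The log-density per channel, affine in the empirical averages; its value at the tilted means is
  -- `D`.
  set L : ℝ × ℝ × ℝ → ℝ := fun v => v.1 * (Real.log x - lowCgf τ θ₀) + θ₀ * v.2.1 +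
    (1 - v.1) * (Real.log (1 - x) - highCgf τ θ₁) + θ₁ * v.2.2 with hL
  have hLD : L (x, s₀, s₁) = D := by
    simp only [hL, hD, dual, tiltedMean, ← hθ₀, ← hθ₁,
      Real.binEntropy_eq_negMulLog_add_negMulLog_one_sub, Real.negMulLog, hs₀, hs₁]
    have e0 : l * (g₀ / x) = θ₀ := by rw [hθ₀]; ring
    have e1 : l * ((1 - g₀) / (1 - x)) = θ₁ := by rw [hθ₁]; ring
    linear_combination (-(x * deriv (lowCgf τ) θ₀)) * e0 +
      (-((1 - x) * deriv (highCgf τ) θ₁)) * e1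
  have hmean : tiltedMean τ g₀ x l = g₀ / x * s₀ + (1 - g₀) / (1 - x) * s₁ := by
    rw [tiltedMean, ← hθ₀, ← hθ₁, hs₀, hs₁]; ring
  have hev1 : ∀ᶠ v in 𝓝 (x, s₀, s₁), L v ≤ D + δ := by
    have hcont : Continuous L := by fun_prop
    have := hcont.tendsto (x, s₀, s₁)
    rw [hLD] at this
    exact this.eventually (ge_mem_nhds (by linarith))
  have hev2 : ∀ᶠ v : ℝ × ℝ × ℝ in 𝓝 (x, s₀, s₁), (x = 1 → v.2.2 = 0) →
      g₀ / v.1 * v.2.1 + (1 - g₀) / (1 - v.1) * v.2.2 ≤ c := by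
    have t0 : Tendsto (fun v : ℝ × ℝ × ℝ => g₀ / v.1 * v.2.1) (𝓝 (x, s₀, s₁))
        (𝓝 (g₀ / x * s₀)) :=
      ContinuousAt.mul (ContinuousAt.div continuousAt_const continuousAt_fst hx0.ne')
        (by fun_prop)
    rw [hmean] at hc
    rcases hx1.eq_or_lt with rfl | hx
    · simp only [sub_self, div_zero, zero_mul, add_zero] at hc
      filter_upwards [t0.eventually (ge_mem_nhds hc)] with v hv hv1
      rw [hv1 rfl]; linarith
    · have t1 : Tendsto (fun v : ℝ × ℝ × ℝ => (1 - g₀) / (1 - v.1) * v.2.2) (𝓝 (x, s₀, s₁))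
          (𝓝 ((1 - g₀) / (1 - x) * s₁)) :=
        ContinuousAt.mul (ContinuousAt.div continuousAt_const (by fun_prop) (sub_pos.2 hx).ne')
          (by fun_prop)
      filter_upwards [(t0.add t1).eventually (ge_mem_nhds hc)] with v hv _ using hv
  rw [hs₀, hs₁] at hev1 hev2
  have hevent := eventually_averages hτ hx0.le hx1 h0 h1 (hev1.and hev2)
  have hprob := isProbabilityMeasure_tiltedLaw hτ hx0.le hx1 h0 h1
  filter_upwards [hevent, eventually_gt_atTop 0] with K hK hK0
  have hK' : (0 : ℝ) < K := by exact_mod_cast hK0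
  rw [← hD]
  set C : ENNReal := ENNReal.ofReal (Real.exp (K * (D + δ))) with hC
  set G : Set (Fin K → ℝ) := {y | gainRate τ g₀ ρ y ≤ ρ * c} with hG
  set S : Set (Fin K → ℝ) := {y | ∏ k, tiltedDensity τ x θ₀ θ₁ (y k) ≤ C} with hS
  have hGm : MeasurableSet G := measurableSet_le (measurable_gainRate _ _ _ _) measurable_const
  have hSm : MeasurableSet S := measurableSet_le
    (Finset.measurable_prod _ fun k _ => measurable_tiltedDensity.comp (measurable_pi_apply k))
    measurable_const
  have hprodle : ∀ y : Fin K → ℝ, L (averages τ y) ≤ D + δ → y ∈ S := fun y hy => by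
    simp only [hS, Set.mem_ofPred_eq]
    refine (Finset.prod_le_prod' fun k _ => tiltedDensity_le hτ hx0 hx1 h0 h1 (y k)).trans ?_
    rw [← ENNReal.ofReal_prod_of_nonneg fun k _ => Real.exp_nonneg _, ← Real.exp_sum, hC]
    refine ENNReal.ofReal_le_ofReal (Real.exp_le_exp.2 ?_)
    calc _ = ∑ k, ((if y k ≤ τ then 1 else 0) * (Real.log x - lowCgf τ θ₀) +
          θ₀ * (if y k ≤ τ then |y k| else 0) +
          (1 - (if y k ≤ τ then 1 else 0)) * (Real.log (1 - x) - highCgf τ θ₁) +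
          θ₁ * (if y k ≤ τ then 0 else |y k|)) :=
          Finset.sum_congr rfl fun k _ => by split_ifs <;> simp
      _ = K * L (averages τ y) := by
          simp only [Finset.sum_add_distrib, ← Finset.mul_sum, ← Finset.sum_mul,
            Finset.sum_sub_distrib, hL, averages, Finset.sum_const, Finset.card_univ,
            Fintype.card_fin, nsmul_eq_mul, mul_one]
          field_simp
      _ ≤ K * (D + δ) := by gcongr
  have hsmall : (Measure.pi fun _ : Fin K => tiltedLaw τ x θ₀ θ₁) (G ∩ S)ᶜ ≤
      ENNReal.ofReal (1 / 2) := by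
    have hae : ∀ᵐ y ∂(Measure.pi fun _ : Fin K => tiltedLaw τ x θ₀ θ₁),
        x = 1 → (averages τ y).2.2 = 0 := by
      by_cases hx : x = 1
      · subst hx
        filter_upwards [ae_averages_one hτ h0 h1 K] with y hy _ using hy
      · exact ae_of_all _ fun y h => absurd h hx
    refine (measure_mono_ae ?_).trans hK
    filter_upwards [hae] with y hy hyc
    change ¬ _
    rintro ⟨hy1, hy2⟩
    refine hyc ⟨?_, hprodle y hy1⟩
    exact (gainRate_le hg₀ hg₁ hρ hK0 y).trans (mul_le_mul_of_nonneg_left (hy2 hy) hρ.le)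
  have hlarge : ENNReal.ofReal (1 / 2) ≤
      (Measure.pi fun _ : Fin K => tiltedLaw τ x θ₀ θ₁) (G ∩ S) := by
    have h := prob_add_prob_compl (μ := Measure.pi fun _ : Fin K => tiltedLaw τ x θ₀ θ₁)
      (hGm.inter hSm)
    by_contra hlt
    have := ENNReal.add_lt_add_of_lt_of_le (by finiteness) (not_le.1 hlt) hsmall
    rw [h, ← ENNReal.ofReal_add (by norm_num) (by norm_num)] at this
    norm_num at this
  have hdens := withDensity_tiltedDensity (τ := τ) (θ₀ := θ₀) (θ₁ := θ₁) hx0.le hx1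
  have hprob' : IsProbabilityMeasure
      ((expMeasure 1).withDensity (tiltedDensity τ x θ₀ θ₁)) := hdens ▸ hprob
  have hle : (Measure.pi fun _ : Fin K => tiltedLaw τ x θ₀ θ₁) (G ∩ S) ≤
      C * (Measure.pi fun _ : Fin K => expMeasure 1) G := by
    rw [← hdens, pi_withDensity _ measurable_tiltedDensity, withDensity_apply _ (hGm.inter hSm)]
    calc _ ≤ ∫⁻ _ in G ∩ S, C ∂(Measure.pi fun _ : Fin K => expMeasure 1) :=
          setLIntegral_mono measurable_const fun y hy => hy.2
      _ = C * (Measure.pi fun _ : Fin K => expMeasure 1) (G ∩ S) := setLIntegral_const _ _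
      _ ≤ _ := by gcongr; exact Set.inter_subset_left
  have hfin := ENNReal.toReal_mono (by finiteness) (hlarge.trans hle)
  rw [ENNReal.toReal_ofReal (by norm_num), ENNReal.toReal_mul, hC,
    ENNReal.toReal_ofReal (Real.exp_nonneg _)] at hfin
  rw [Real.exp_neg, ← div_eq_mul_inv, div_le_iff₀ (Real.exp_pos _), mul_comm]
  exact hfin

/-! ### Reduction of the fading model to a product of exponential laws, and the closed formulas. -/

lemma numLow_eq_numChannels (τ : ℝ) (K : ℕ) (h : ℕ → ℂ) :
    numLow τ (fun k : Fin K => ‖h k‖ ^ 2) = numChannels τ K h 0 := by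
  rw [numLow, numChannels, Finset.card_filter, Nat.cast_sum,
    Fin.sum_univ_eq_sum_range (fun k => if ‖h k‖ ^ 2 ≤ τ then (1 : ℝ) else 0)]
  refine Finset.sum_congr rfl fun k _ => ?_
  by_cases hk : ‖h k‖ ^ 2 ≤ τ <;> simp [feedback, hk]

lemma numChannels_one (τ : ℝ) (K : ℕ) (h : ℕ → ℂ) :
    (numChannels τ K h 1 : ℝ) = K - numChannels τ K h 0 := by
  have h1 : numChannels τ K h 0 + numChannels τ K h 1 = K := by
    have hc := Finset.card_filter_add_card_filter_not (s := Finset.range K)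
      (fun k => feedback τ (h k) = 0)
    rw [Finset.card_range] at hc
    have he : (Finset.range K).filter (fun k => feedback τ (h k) = 1) =
        (Finset.range K).filter fun k => ¬ feedback τ (h k) = 0 :=
      Finset.filter_congr fun k _ => by
        by_cases hk : ‖h k‖ ^ 2 ≤ τ <;> simp [feedback, hk]
    rw [numChannels, numChannels, he, hc]
  rw [eq_sub_iff_add_eq, add_comm]
  exact_mod_cast h1

lemma rate_eq_gainRate (τ g₀ ρ : ℝ) (K : ℕ) (h : ℕ → ℂ) :
    rate τ g₀ ρ K h = gainRate τ g₀ ρ fun k : Fin K => ‖h k‖ ^ 2 := by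
  rw [rate, gainRate, numLow_eq_numChannels, ← numChannels_one,
    Fin.sum_univ_eq_sum_range (fun k => if ‖h k‖ ^ 2 ≤ τ then
      Real.log (1 + g₀ / (numChannels τ K h 0 : ℝ) * ρ * |‖h k‖ ^ 2|)
      else Real.log (1 + (1 - g₀) / (numChannels τ K h 1 : ℝ) * ρ * |‖h k‖ ^ 2|))]
  refine Finset.sum_congr rfl fun k _ => ?_
  have habs : |‖h k‖ ^ 2| = ‖h k‖ ^ 2 := abs_of_nonneg (by positivity)
  by_cases hk : ‖h k‖ ^ 2 ≤ τ <;> simp [power, feedback, hk]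

lemma outageProb_eq {Ω : Type*} [MeasurableSpace Ω] {μ : Measure Ω} [IsProbabilityMeasure μ]
    {H : ℕ → Ω → ℂ} (hH : IsRayleighFading μ H) (τ g₀ ρ r : ℝ) (K : ℕ) :
    outageProb μ H τ g₀ ρ r K =
      (Measure.pi fun _ : Fin K => expMeasure 1) {y | gainRate τ g₀ ρ y ≤ r} := by
  have hind : iIndepFun (fun (k : Fin K) ω => ‖H k ω‖ ^ 2) μ :=
    (hH.indep.precomp Fin.val_injective).comp (fun _ z => ‖z‖ ^ 2) fun _ => by fun_prop
  have hm : ∀ k : Fin K, AEMeasurable (fun ω => ‖H k ω‖ ^ 2) μ := fun k => (hH.law k).aemeasurable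
  have hmap := (iIndepFun_iff_map_fun_eq_pi_map hm).1 hind
  simp_rw [fun k : Fin K => (hH.law k).map_eq] at hmap
  rw [← hmap, Measure.map_apply_of_aemeasurable (aemeasurable_pi_lambda _ hm)
    (measurableSet_le (measurable_gainRate _ _ _ _) measurable_const), outageProb]
  simp only [rate_eq_gainRate]
  rfl

lemma E0_eq {τ g₀ η : ℝ} (hτ : 0 < τ) (hg₀ : 0 ≤ g₀) :
    E0 τ g₀ η = ⨆ (l : ℝ) (_ : l ≤ 0), ((dual τ g₀ 1 l + l * η⁻¹ : ℝ) : EReal) := by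
  refine iSup_congr fun l => iSup_congr fun hl => ?_
  have h := low_param_nonpos hg₀ zero_le_one hl
  congr 1
  rw [dual, lowCgf_eq hτ (h.trans_lt one_pos)]
  simp only [div_one, sub_self, zero_mul, one_mul, Real.binEntropy_one]
  ring

lemma E1_eq {τ g₀ η x : ℝ} (hτ : 0 < τ) (hg₀ : 0 ≤ g₀) (hg₁ : g₀ ≤ 1) (hx : x ∈ Set.Ioo (0 : ℝ) 1) :
    E1 τ g₀ η x = ⨆ (l : ℝ) (_ : l ≤ 0), ((dual τ g₀ x l + l * η⁻¹ : ℝ) : EReal) := by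
  refine iSup_congr fun l => iSup_congr fun hl => ?_
  have h0 := low_param_nonpos hg₀ hx.1.le hl
  have h1 := high_param_nonpos hg₁ hx.2.le hl
  have hx1 : 0 < 1 - x := sub_pos.2 hx.2
  have hx0 := hx.1
  congr 1
  obtain ⟨a, ha⟩ : ∃ a, a = 1 - g₀ / x * l := ⟨_, rfl⟩
  obtain ⟨b, hb⟩ : ∃ b, b = 1 - (1 - g₀) / (1 - x) * l := ⟨_, rfl⟩
  have ha0 : 0 < a := by linarith
  have hb0 : 0 < b := by linarith
  have e1 : 1 - g₀ * l / x = a := by rw [ha]; ring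
  have e2 : x - g₀ * l = x * a := by rw [ha]; field_simp
  have e3 : 1 - x - (1 - g₀) * l = (1 - x) * b := by rw [hb]; field_simp
  have hexp : Real.exp (a * τ) - 1 = Real.exp (a * τ) * (1 - Real.exp (-(a * τ))) := by
    rw [mul_sub, ← Real.exp_add]; simp
  have hlt : Real.exp (-(a * τ)) < 1 := by
    rw [Real.exp_lt_one_iff]; have := mul_pos ha0 hτ; linarith
  rw [dual, lowCgf_eq hτ (h0.trans_lt one_pos), highCgf_eq hτ (h1.trans_lt one_pos), e1, e2, e3,
    hexp, Real.log_mul (Real.exp_ne_zero _) (by linarith), Real.log_exp,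
    Real.log_mul hx0.ne' ha0.ne', Real.log_mul hx1.ne' hb0.ne', ← ha, ← hb,
    Real.binEntropy_eq_negMulLog_add_negMulLog_one_sub, Real.negMulLog, Real.negMulLog]
  -- The terms in `τ` match because `x * a + (1 - x) * b = 1 - l`.
  linear_combination τ * e2 + τ * e3

/-! ### Exponential rates and the limit. -/

/-- The outage probability decays exponentially at any rate below the exponent. -/
lemma eventually_pi_le {τ g₀ ρ c M : ℝ} (hτ : 0 < τ) (hg₀ : 0 ≤ g₀) (hg₁ : g₀ ≤ 1)
    (hρ : 0 < ρ) (hc : 0 < c) (hM : ∀ x ∈ Set.Ioc (0 : ℝ) 1, ∃ l ≤ 0, M < dual τ g₀ x l + l * c)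
    {M' : ℝ} (hM' : M' < M) :
    ∀ᶠ K : ℕ in atTop, (Measure.pi fun _ : Fin K => expMeasure 1).real
      {y | gainRate τ g₀ ρ y ≤ ρ * c} ≤ Real.exp (-(K * M')) := by
  obtain ⟨N, hN, hNM⟩ := exists_between hM'
  -- Tube lemma: the parameter `l` may depend on `x`, but the threshold on `K` must not.
  have hcomp := (isCompact_Icc (a := (0 : ℝ)) (b := 1)).mem_prod_nhdsSet_of_forall
    (l := (atTop : Filter ℕ))
    (s := {p | p.2 ∈ Set.Icc (0 : ℝ) 1 → ∃ l ≤ 0, N < chernoffExp τ g₀ ρ c l p.1 p.2})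
    fun x hx => by
      obtain ⟨l, hl, h⟩ := eventually_lt_chernoffExp hτ hg₀ hg₁ hρ hc hM hNM hx.1 hx.2
      filter_upwards [h] with p hp hpx using ⟨l, hl, hp hpx⟩
  have hev : ∀ᶠ K : ℕ in atTop, ∀ x ∈ Set.Icc (0 : ℝ) 1, ∃ l ≤ 0,
      N < chernoffExp τ g₀ ρ c l K x := by
    obtain ⟨A, hA, B, hB, hAB⟩ := mem_prod_iff.1 hcomp
    filter_upwards [hA] with K hK x hx
    exact hAB (Set.mk_mem_prod hK (subset_of_mem_nhdsSet hB hx)) hx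
  -- The gap between `N` and `M'` absorbs the factor `K + 1` from the union over counts.
  have hpoly : ∀ᶠ K : ℕ in atTop, ((K : ℝ) + 1) * Real.exp (-(N - M') * K) ≤ 1 := by
    have h0 : 0 < N - M' := by linarith
    have h1 : Tendsto (fun t : ℝ => t * Real.exp (-(N - M') * t)) atTop (𝓝 0) := by
      simpa using tendsto_rpow_mul_exp_neg_mul_atTop_nhds_zero 1 _ h0
    have h2 : Tendsto (fun t : ℝ => Real.exp (-(N - M') * t)) atTop (𝓝 0) := by
      simpa using tendsto_rpow_mul_exp_neg_mul_atTop_nhds_zero 0 _ h0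
    have h3 := (h1.add h2).comp tendsto_natCast_atTop_atTop
    rw [add_zero] at h3
    filter_upwards [h3.eventually (ge_mem_nhds one_pos)] with K hK
    simp only [Function.comp] at hK
    linarith
  filter_upwards [hev, hpoly, eventually_gt_atTop 0] with K hK hp hK0
  have hK' : (0 : ℝ) < K := by exact_mod_cast hK0
  have hsub : {y : Fin K → ℝ | gainRate τ g₀ ρ y ≤ ρ * c} ⊆ ⋃ n ∈ Finset.range (K + 1),
      {y | numLow τ y = (n : ℕ) ∧ gainRate τ g₀ ρ y ≤ ρ * c} := fun y hy => by
    simp only [Set.mem_iUnion]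
    refine ⟨_, ?_, numLow_eq_card τ y, hy⟩
    rw [Finset.mem_range, Nat.lt_succ_iff]
    exact (Finset.card_filter_le _ _).trans (by simp)
  calc _ ≤ ∑ n ∈ Finset.range (K + 1), (Measure.pi fun _ : Fin K => expMeasure 1).real
          {y | numLow τ y = (n : ℕ) ∧ gainRate τ g₀ ρ y ≤ ρ * c} :=
        (measureReal_mono hsub (measure_ne_top _ _)).trans (measureReal_biUnion_finset_le _ _)
    _ ≤ ∑ n ∈ Finset.range (K + 1), Real.exp (-(K * N)) := by
        refine Finset.sum_le_sum fun n hn => ?_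
        have hn' : n ≤ K := Nat.lt_succ_iff.1 (Finset.mem_range.1 hn)
        obtain ⟨l, hl, h⟩ := hK (n / K) ⟨by positivity,
          (div_le_one hK').2 (by exact_mod_cast hn')⟩
        refine (chernoff_bound (c := c) hτ hg₀ hg₁ hρ hl hK0 hn').trans (Real.exp_le_exp.2 ?_)
        have := mul_le_mul_of_nonneg_left h.le hK'.le
        linarith
    _ = (((K : ℝ) + 1) * Real.exp (-(N - M') * K)) * Real.exp (-(K * M')) := by
        rw [Finset.sum_const, Finset.card_range, nsmul_eq_mul, mul_assoc, ← Real.exp_add]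
        push_cast
        congr 2; ring
    _ ≤ 1 * Real.exp (-(K * M')) := by gcongr
    _ = _ := one_mul _

/-- The outage probability decays no faster than any exponential rate above the exponent. -/
lemma eventually_le_pi {τ g₀ ρ c x E E' M₀ c₀ : ℝ} (hτ : 0 < τ) (hg₀ : 0 ≤ g₀) (hg₁ : g₀ ≤ 1)
    (hρ : 0 < ρ) (hx : x ∈ Set.Ioc (0 : ℝ) 1) (hc : c₀ < c)
    (hM₀ : ∀ l ≤ 0, dual τ g₀ x l + l * c₀ ≤ M₀) (hE : ∀ l ≤ 0, dual τ g₀ x l + l * c ≤ E)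
    (hE' : E < E') :
    ∀ᶠ K : ℕ in atTop, Real.exp (-(K * E')) ≤ (Measure.pi fun _ : Fin K => expMeasure 1).real
      {y | gainRate τ g₀ ρ y ≤ ρ * c} := by
  -- One third of the gap each for the choice of tilt, the fluctuation of the averages and the
  -- factor `1/2`.
  obtain ⟨δ, hδ⟩ : ∃ δ, δ = (E' - E) / 3 := ⟨_, rfl⟩
  have hδ0 : 0 < δ := by linarith
  obtain ⟨l, hl, hm, hval⟩ := exists_tilt
    (fun l hl => hasDerivAt_dual (τ := τ) hg₀ hg₁ hx.1.le hx.2 hl) hc hM₀ hE hδ0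
  rw [neg_neg] at hm
  have hlim : Tendsto (fun K : ℕ => (K : ℝ) * δ) atTop atTop :=
    tendsto_natCast_atTop_atTop.atTop_mul_const hδ0
  filter_upwards [eventually_le_pi_gainRate hτ hg₀ hg₁ hρ hx.1 hx.2 hl hm hδ0,
    hlim.eventually_ge_atTop (Real.log 2)] with K hK h2
  refine le_trans ?_ hK
  have e : (1 / 2 : ℝ) = Real.exp (-Real.log 2) := by
    rw [Real.exp_neg, Real.exp_log two_pos]; norm_num
  rw [e, ← Real.exp_add, Real.exp_le_exp]
  have : (K : ℝ) * (dual τ g₀ x l + l * tiltedMean τ g₀ x l + δ + δ) ≤ K * E' := by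
    gcongr; linarith
  linarith

lemma le_neg_log_div {p : ENNReal} {K : ℕ} (hK : 0 < K) {M : ℝ}
    (h : p ≤ ENNReal.ofReal (Real.exp (-(K * M)))) :
    (M : EReal) ≤ -ENNReal.log p / (K : EReal) := by
  have h1 := ENNReal.log_monotone h
  rw [ENNReal.log_ofReal_of_pos (Real.exp_pos _), Real.log_exp] at h1
  rw [EReal.le_div_iff_mul_le (by exact_mod_cast hK) (EReal.natCast_ne_top K)]
  refine le_trans (le_of_eq ?_) (EReal.neg_le_neg_iff.2 h1)
  rw [← EReal.coe_neg, neg_neg, mul_comm (K : ℝ)]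
  push_cast
  rfl

lemma neg_log_div_le {p : ENNReal} {K : ℕ} (hK : 0 < K) {M : ℝ}
    (h : ENNReal.ofReal (Real.exp (-(K * M))) ≤ p) :
    -ENNReal.log p / (K : EReal) ≤ M := by
  have h1 := ENNReal.log_monotone h
  rw [ENNReal.log_ofReal_of_pos (Real.exp_pos _), Real.log_exp] at h1
  rw [EReal.div_le_iff_le_mul (by exact_mod_cast hK) (EReal.natCast_ne_top K)]
  refine (EReal.neg_le_neg_iff.2 h1).trans (le_of_eq ?_)
  rw [← EReal.coe_neg, neg_neg]
  push_cast
  rfl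

/-- Channels with feedback `1` have squared moduli above `τ`, so for `x < 1` their linearized rate
always exceeds `(1 - g₀) * τ * ρ`. -/
lemma E1_eq_top {τ g₀ η x : ℝ} (hτ : 0 < τ) (hg₀ : 0 ≤ g₀) (hg₁ : g₀ ≤ 1) (hη : 0 < η)
    (h : η⁻¹ ≤ (1 - g₀) * τ) (hx : x ∈ Set.Ioo (0 : ℝ) 1) : E1 τ g₀ η x = ⊤ := by
  rw [E1_eq hτ hg₀ hg₁ hx, EReal.eq_top_iff_forall_lt]
  intro M
  have hg : g₀ < 1 := by
    by_contra hn
    have : g₀ = 1 := by linarith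
    subst this
    simp only [sub_self, zero_mul] at h
    exact absurd h (not_le.2 (inv_pos.2 hη))
  obtain ⟨l, hl, hM⟩ := exists_lt_dual hτ hg₀ hg hx.1.le hx.2 h M
  exact lt_of_lt_of_le (EReal.coe_lt_coe_iff.2 hM) (le_iSup₂_of_le l hl le_rfl)

/-- The outage exponent at every energy per nat. -/
theorem hasOutageExponent {Ω : Type*} [MeasurableSpace Ω] {μ : Measure Ω} [IsProbabilityMeasure μ]
    {H : ℕ → Ω → ℂ} (hH : IsRayleighFading μ H) {τ g₀ ρ η : ℝ} (hτ : 0 < τ) (hg₀ : 0 ≤ g₀)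
    (hg₁ : g₀ ≤ 1) (hρ : 0 < ρ) (hη : 0 < η) :
    HasOutageExponent μ H τ g₀ ρ η
      (min (⨅ x ∈ Set.Ioo (0 : ℝ) 1, E1 τ g₀ η x) (E0 τ g₀ η)) := by
  have hc : 0 < η⁻¹ := inv_pos.2 hη
  have hP : ∀ K, outageProb μ H τ g₀ ρ (ρ / η) K = ENNReal.ofReal
      ((Measure.pi fun _ : Fin K => expMeasure 1).real {y | gainRate τ g₀ ρ y ≤ ρ * η⁻¹}) :=
    fun K => by rw [outageProb_eq hH, ofReal_measureReal, div_eq_mul_inv]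
  rw [HasOutageExponent, tendsto_order]
  constructor
  · intro a ha
    obtain ⟨M, hM1, hM2⟩ := EReal.lt_iff_exists_real_btwn.1 ha
    obtain ⟨M', hM'1, hM'2⟩ := EReal.lt_iff_exists_real_btwn.1 hM1
    rw [lt_min_iff] at hM2
    have hM : ∀ x ∈ Set.Ioc (0 : ℝ) 1, ∃ l ≤ 0, M < dual τ g₀ x l + l * η⁻¹ := fun x hx => by
      have hlt : (M : EReal) < ⨆ (l : ℝ) (_ : l ≤ 0),
          ((dual τ g₀ x l + l * η⁻¹ : ℝ) : EReal) := by
        rcases hx.2.eq_or_lt with rfl | h1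
        · rw [← E0_eq hτ hg₀]; exact hM2.2
        · rw [← E1_eq hτ hg₀ hg₁ ⟨hx.1, h1⟩]
          exact hM2.1.trans_le (iInf₂_le x ⟨hx.1, h1⟩)
      obtain ⟨l, hl⟩ := lt_iSup_iff.1 hlt
      obtain ⟨hl0, hl⟩ := lt_iSup_iff.1 hl
      exact ⟨l, hl0, EReal.coe_lt_coe_iff.1 hl⟩
    filter_upwards [eventually_pi_le hτ hg₀ hg₁ hρ hc hM (EReal.coe_lt_coe_iff.1 hM'2),
      eventually_gt_atTop 0] with K hK hK0
    refine hM'1.trans_le (le_neg_log_div hK0 ?_)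
    rw [hP]
    exact ENNReal.ofReal_le_ofReal hK
  · intro a ha
    obtain ⟨E', hE1, hE2⟩ := EReal.lt_iff_exists_real_btwn.1 ha
    obtain ⟨E, hE3, hE4⟩ := EReal.lt_iff_exists_real_btwn.1 hE1
    have hE5 := EReal.coe_lt_coe_iff.1 hE4
    -- Some fraction `x` nearly attains the minimum. Finiteness of its exponent leaves room for a
    -- level `c₀` strictly below `η⁻¹` that still has a finite bound, as `exists_tilt` requires.
    have key : ∃ x ∈ Set.Ioc (0 : ℝ) 1, ∃ c₀ < η⁻¹, ∃ M₀,
        (∀ l ≤ 0, dual τ g₀ x l + l * c₀ ≤ M₀) ∧ ∀ l ≤ 0, dual τ g₀ x l + l * η⁻¹ ≤ E := by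
      have conv : ∀ {x : ℝ}, (⨆ (l : ℝ) (_ : l ≤ 0), ((dual τ g₀ x l + l * η⁻¹ : ℝ) : EReal)) < E →
          ∀ l ≤ 0, dual τ g₀ x l + l * η⁻¹ ≤ E := fun h l hl =>
        EReal.coe_le_coe_iff.1 ((le_iSup₂_of_le l hl le_rfl).trans h.le)
      rcases min_lt_iff.1 hE3 with h | h
      · obtain ⟨x, h⟩ := iInf_lt_iff.1 h
        obtain ⟨hx, h⟩ := iInf_lt_iff.1 h
        have hgt : (1 - g₀) * τ < η⁻¹ := by
          by_contra hn
          rw [E1_eq_top hτ hg₀ hg₁ hη (not_lt.1 hn) hx] at h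
          exact not_top_lt h
        obtain ⟨c₀, h1, h2⟩ := exists_between hgt
        obtain ⟨M₀, hM₀⟩ := exists_dual_le hτ hg₀ hg₁ hx.1 hx.2 h1
        rw [E1_eq hτ hg₀ hg₁ hx] at h
        exact ⟨x, Set.Ioo_subset_Ioc_self hx, c₀, h2, M₀, hM₀, conv h⟩
      · obtain ⟨c₀, h1, h2⟩ := exists_between hc
        obtain ⟨M₀, hM₀⟩ := exists_dual_one_le hg₀ hg₁ hτ h1
        rw [E0_eq hτ hg₀] at h
        exact ⟨1, by simp, c₀, h2, M₀, hM₀, conv h⟩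
    obtain ⟨x, hx, c₀, hc₀, M₀, hM₀, hE⟩ := key
    filter_upwards [eventually_le_pi hτ hg₀ hg₁ hρ hx hc₀ hM₀ hE hE5,
      eventually_gt_atTop 0] with K hK hK0
    refine (neg_log_div_le hK0 ?_).trans_lt hE2
    rw [hP]
    exact ENNReal.ofReal_le_ofReal hK

end Wideband

theorem proposition5 {Ω : Type*} [MeasurableSpace Ω] (μ : Measure Ω) [IsProbabilityMeasure μ]
    (H : ℕ → Ω → ℂ) (hH : Wideband.IsRayleighFading μ H)
    (τ g₀ ρ η : ℝ) (hτ : 0 < τ) (hg₀ : 0 ≤ g₀) (hg₁ : g₀ ≤ 1) (hρ : 0 < ρ) (hη : 0 < η) :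
    (Wideband.etaBar τ g₀ ≤ η → η * ((1 - g₀) * τ) ≤ 1 →
      Wideband.HasOutageExponent μ H τ g₀ ρ η
        (min (⨅ x ∈ Set.Ioo (0 : ℝ) 1, Wideband.E1 τ g₀ η x) (Wideband.E0 τ g₀ η))) ∧
    (1 < η * ((1 - g₀) * τ) →
      Wideband.HasOutageExponent μ H τ g₀ ρ η (Wideband.E0 τ g₀ η)) := by
  have h := Wideband.hasOutageExponent hH hτ hg₀ hg₁ hρ hη
  refine ⟨fun _ _ => h, fun hη1 => ?_⟩
  have hc : η⁻¹ ≤ (1 - g₀) * τ := by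
    rw [inv_le_iff_one_le_mul₀' hη]; exact hη1.le
  have htop : (⨅ x ∈ Set.Ioo (0 : ℝ) 1, Wideband.E1 τ g₀ η x) = ⊤ :=
    iInf₂_eq_top.2 fun x hx => Wideband.E1_eq_top hτ hg₀ hg₁ hη hc hx
  rwa [htop, min_eq_right le_top] at h
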